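/- Matrices carry the operator norm induced by the Euclidean norms on $\mathbb{C}^n$, and for a bounded matrix function $A$ we write $\|A\|$ for the supremum of its matrix norm over its domain. A system $\partial_x\psi=A(x)\psi$ with continuous $A\colon\mathbb{R}\to\mathrm{Mat}_{n\times n}(\mathbb{C})$ and evolution operator $T(x,y)$ has an exponential dichotomy on $\mathbb{R}$ with constants $K,\mu>0$ if there are projections $P(x)$, $x\in\mathbb{R}$, with $P(x)T(x,y)=T(x,y)P(y)$ for all $x,y$, $\|T(x,y)P(y)\|\le Ke^{-\mu(x-y)}$ for $x\ge y$ and $\|T(x,y)(I-P(y))\|\le Ke^{-\mu(y-x)}$ for $y\ge x$. **Theorem.** Let $n_1,n_2\in\mathbb{Z}_{>0}$, $\epsilon_0>0$, and let $A_{ij}\colon\mathbb{R}\times(0,\epsilon_0)\to\mathrm{Mat}_{n_i\times n_j}(\mathbb{C})$, $i,j=1,2$, be bounded and continuous. Assume that for every $\epsilon\in(0,\epsilon_0)$ the system $\partial_x\psi=A_{22}(x,\epsilon)\psi$ has an exponential dichotomy on $\mathbb{R}$ with constants $K_0,\mu_0>0$ independent of $\epsilon$. Then for all sufficiently small $\epsilon>0$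 there exist continuously differentiable functions $U_\epsilon\colon\mathbb{R}\to\mathrm{Mat}_{n_2\times n_1}(\mathbb{C})$ and $S_\epsilon\colon\mathbb{R}\to\mathrm{Mat}_{n_1\times n_2}(\mathbb{C})$ satisfying $$\partial_xU=A_{22}U-\epsilon UA_{11}-\epsilon UA_{12}U+A_{21},\qquad \partial_xS=\epsilon(A_{11}+A_{12}U)S-S(A_{22}-\epsilon UA_{12})-A_{12},$$ with the following properties. 1. $\|U_\epsilon\|\le 8K_0\mu_0^{-1}\|A_{21}\|$ and $\|S_\epsilon\|\le 8C_1\mu_0^{-1}\|A_{12}\|$, where $C_1>0$ depends on $K_0$ only. 2. The coordinate change $$\begin{pmatrix}\phi\\ \psi\end{pmatrix}=H_\epsilon(x)\begin{pmatrix}\chi\\ \omega\end{pmatrix},\qquad H_\epsilon(x)=\begin{pmatrix}I&-\epsilon S_\epsilon(x)\\ U_\epsilon(x)&I-\epsilon U_\epsilon(x)S_\epsilon(x)\end{pmatrix},$$ is invertible for every $x\in\mathbb{R}$ and transforms the system $\partial_x\phi=\epsilon(A_{11}\phi+A_{12}\psi)$, $\partial_x\psi=A_{21}\phi+A_{22}\psi$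 into the block-diagonal system $\partial_x\chi=\epsilon(A_{11}+A_{12}U_\epsilon)\chi$, $\partial_x\omega=(A_{22}-\epsilon U_\epsilon A_{12})\omega$; that is, $(\chi,\omega)$ solves the latter if and only if $(\phi,\psi)$ solves the former. 3. The equation $\partial_x\Omega=A_{22}(x,\epsilon)\Omega+A_{21}(x,\epsilon)$ has a unique bounded solution $\Omega_\epsilon\colon\mathbb{R}\to\mathrm{Mat}_{n_2\times n_1}(\mathbb{C})$, and for every $\theta\in(0,1)$ and $x\in\mathbb{R}$ $$\|U_\epsilon(x)-\Omega_\epsilon(x)\|\le C_3\,\epsilon^{1-\theta},$$ where $C_3>0$ depends on $K_0,\mu_0,\|A_{11}\|,\|A_{12}\|,\|A_{21}\|$ only. 4. For every $a>0$ and $x\in\mathbb{R}$ $$\|U_\epsilon(x)\|\le\frac{4K_0}{\mu_0}\Bigl[\sup_{y\in[x-a,x+a]}\bigl(\epsilon\|A_{12}\|\,\|U_\epsilon(y)\|^2+\|A_{21}(y,\epsilon)\|\bigr)+C_4e^{-a\mu_0/2}\Bigr],$$ where $C_4>0$ depends on $K_0,\mu_0,\|A_{12}\|,\|A_{21}\|$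 only. 5. If the matrix functions $A_{ij}(\cdot,\epsilon)$, $1\le i,j\le2$, are $L$-periodic, then $H_\epsilon$ is $L$-periodic. -/

import Mathlib

/- All matrices carry the operator norm induced by the Euclidean norms. -/
open scoped Matrix Matrix.Norms.L2Operator BoundedContinuousFunction

namespace SlowFast

/-- `z` is a solution on `ℝ` of the linear system `z' = M(x) z`. -/
def IsSolution {ι : Type} [Fintype ι] (M : ℝ → Matrix ι ι ℂ) (z : ℝ → ι → ℂ) : Prop :=
  ∀ x, HasDerivAt z (M x *ᵥ z x) x

/-- `T(x,y)` is the evolution operator of `z' = M(x) z`. -/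
def IsEvolution {n : ℕ} (M : ℝ → Matrix (Fin n) (Fin n) ℂ)
    (T : ℝ → ℝ → Matrix (Fin n) (Fin n) ℂ) : Prop :=
  ∀ y, T y y = 1 ∧ ∀ x, HasDerivAt (fun s => T s y) (M x * T x y) x

/-- The system `z' = M(x) z` has an exponential dichotomy on `ℝ` with constants `K, μ`. -/
def HasExpDichotomy {n : ℕ} (M : ℝ → Matrix (Fin n) (Fin n) ℂ) (K μ : ℝ) : Prop :=
  ∃ (T : ℝ → ℝ → Matrix (Fin n) (Fin n) ℂ) (P : ℝ → Matrix (Fin n) (Fin n) ℂ),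
    IsEvolution M T ∧
    (∀ x, P x * P x = P x) ∧
    (∀ x y, P x * T x y = T x y * P y) ∧
    (∀ x y, y ≤ x → ‖T x y * P y‖ ≤ K * Real.exp (-μ * (x - y))) ∧
    (∀ x y, x ≤ y → ‖T x y * (1 - P y)‖ ≤ K * Real.exp (-μ * (y - x)))

/-- The coordinate change `z = H(x) w` is invertible and turns the system `z' = M(x) z` into the
system `w' = N(x) w`. -/
def Transforms {ι : Type} [Fintype ι] [DecidableEq ι] (H M N : ℝ → Matrix ι ι ℂ) : Prop :=
  (∀ x, IsUnit (H x)) ∧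
    ∀ w : ℝ → ι → ℂ, IsSolution N w ↔ IsSolution M (fun x => H x *ᵥ w x)

section

variable {n₁ n₂ : ℕ} (ε : ℝ)
  (A₁₁ : ℝ → Matrix (Fin n₁) (Fin n₁) ℂ) (A₁₂ : ℝ → Matrix (Fin n₁) (Fin n₂) ℂ)
  (A₂₁ : ℝ → Matrix (Fin n₂) (Fin n₁) ℂ) (A₂₂ : ℝ → Matrix (Fin n₂) (Fin n₂) ℂ)
  (U : ℝ → Matrix (Fin n₂) (Fin n₁) ℂ) (S : ℝ → Matrix (Fin n₁) (Fin n₂) ℂ)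

/-- Coefficient matrix of the coupled system
`φ' = ε (A₁₁ φ + A₁₂ ψ)`, `ψ' = A₂₁ φ + A₂₂ ψ`. -/
def coupled (x : ℝ) : Matrix (Fin n₁ ⊕ Fin n₂) (Fin n₁ ⊕ Fin n₂) ℂ :=
  Matrix.fromBlocks ((ε : ℂ) • A₁₁ x) ((ε : ℂ) • A₁₂ x) (A₂₁ x) (A₂₂ x)

/-- Coefficient matrix of the decoupled system
`χ' = ε (A₁₁ + A₁₂ U) χ`, `ω' = (A₂₂ - ε U A₁₂) ω`. -/
def decoupled (x : ℝ) : Matrix (Fin n₁ ⊕ Fin n₂) (Fin n₁ ⊕ Fin n₂) ℂ :=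
  Matrix.fromBlocks ((ε : ℂ) • (A₁₁ x + A₁₂ x * U x)) 0 0 (A₂₂ x - (ε : ℂ) • (U x * A₁₂ x))

/-- The Riccati transformation `H`. -/
def riccatiTransform (x : ℝ) : Matrix (Fin n₁ ⊕ Fin n₂) (Fin n₁ ⊕ Fin n₂) ℂ :=
  Matrix.fromBlocks 1 (-((ε : ℂ) • S x)) (U x) (1 - (ε : ℂ) • (U x * S x))

/-- `U` and `S` are continuously differentiable solutions of the matrix Riccati equations. -/
def IsRiccatiPair : Prop :=
  ContDiff ℝ 1 U ∧ ContDiff ℝ 1 S ∧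
  (∀ x, HasDerivAt U
    (A₂₂ x * U x - (ε : ℂ) • (U x * A₁₁ x) - (ε : ℂ) • (U x * A₁₂ x * U x) + A₂₁ x) x) ∧
  (∀ x, HasDerivAt S
    ((ε : ℂ) • ((A₁₁ x + A₁₂ x * U x) * S x) - S x * (A₂₂ x - (ε : ℂ) • (U x * A₁₂ x)) - A₁₂ x) x)

/-- `Ω` is a bounded solution of `Ω' = A₂₂ Ω + A₂₁`. -/
def IsBoundedInhomSolution (Ω : ℝ → Matrix (Fin n₂) (Fin n₁) ℂ) : Prop :=
  (∃ B : ℝ, ∀ x, ‖Ω x‖ ≤ B) ∧ ∀ x, HasDerivAt Ω (A₂₂ x * Ω x + A₂₁ x) x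

end

end SlowFast

namespace SlowFast

open Set Filter Topology MeasureTheory

/-! ### Calculus of matrix functions and exponential integrals. -/

section Calculus

variable {l m n : Type*} [Fintype l] [Fintype m] [Fintype n]

/-! Everything rests on the Green operator of a dichotomy: `V' = M V + f` with bounded `f` has
exactly one bounded solution, obtained by integrating `T(x,y) P(y) f(y)` over `y ≤ x` and
subtracting the integral of `T(x,y) (1 - P(y)) f(y)` over `y > x`. A forcing bounded by a sum of
terms `c * exp (κ y)` with `|κ| < μ` gives the same kind of bound for the solution, each term
multiplied by `K (1/(μ+κ) + 1/(μ-κ))` (`HasExpDichotomy.norm_le_sum_exp`). For `κ = 0` this factor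
is `2K/μ`.

For small `ε` the Riccati equation for `U` is then a contraction problem on a ball of bounded
functions. The equation for `S` is linear once `U` is known; its conjugate transpose is a
perturbation of the adjoint system `z' = -A₂₂ᴴ z`, which has a dichotomy with the same constants, so
the same fixed point argument applies (`HasExpDichotomy.exists_semilinear`). Uniqueness in the ball
gives periodicity.

The two equations say precisely that `H' = M H - H N`, with `M` the coupled and `N` the decoupled
coefficients, which gives the block diagonalization. The difference `U - Ω` is a bounded solution
with forcing of size `O(ε)`, hence is itself `O(ε)`. The local estimate compares `U` with a weight
that is small near `x` and grows at rate `μ/2` away from it, slowly enough for the Green operator to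
preserve it (`HasExpDichotomy.local_norm_le`). -/

theorem hasDerivAt_matrix_iff {m n : Type*} [Finite m] [Fintype n]
    {A : ℝ → Matrix m n ℂ} {A' : Matrix m n ℂ} {x : ℝ} :
    HasDerivAt A A' x ↔ ∀ i j, HasDerivAt (fun t => A t i j) (A' i j) x :=
  (hasDerivAt_pi (E' := fun _ : m => n → ℂ)).trans (forall_congr' fun _ => hasDerivAt_pi)

theorem hasDerivAt_matrix_mul {A : ℝ → Matrix l m ℂ} {B : ℝ → Matrix m n ℂ}
    {A' : Matrix l m ℂ} {B' : Matrix m n ℂ} {x : ℝ}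
    (hA : HasDerivAt A A' x) (hB : HasDerivAt B B' x) :
    HasDerivAt (fun t => A t * B t) (A' * B x + A x * B') x := by
  rw [hasDerivAt_matrix_iff] at *
  intro i j
  simp only [Matrix.mul_apply, Matrix.add_apply, ← Finset.sum_add_distrib]
  exact HasDerivAt.fun_sum fun k _ => (hA i k).mul (hB k j)

theorem hasDerivAt_matrix_mulVec {A : ℝ → Matrix m n ℂ} {z : ℝ → n → ℂ}
    {A' : Matrix m n ℂ} {z' : n → ℂ} {x : ℝ}
    (hA : HasDerivAt A A' x) (hz : HasDerivAt z z' x) :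
    HasDerivAt (fun t => A t *ᵥ z t) (A' *ᵥ z x + A x *ᵥ z') x := by
  rw [hasDerivAt_matrix_iff] at hA
  rw [hasDerivAt_pi] at hz ⊢
  intro i
  simp only [Matrix.mulVec, dotProduct, Pi.add_apply, ← Finset.sum_add_distrib]
  exact HasDerivAt.fun_sum fun k _ => (hA i k).mul (hz k)

theorem hasDerivAt_matrix_conjTranspose {A : ℝ → Matrix m n ℂ} {A' : Matrix m n ℂ} {x : ℝ}
    (hA : HasDerivAt A A' x) : HasDerivAt (fun t => (A t)ᴴ) A'ᴴ x := by
  rw [hasDerivAt_matrix_iff] at *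
  intro i j
  exact (hA j i).star

theorem hasDerivAt_matrix_fromBlocks {p : Type*} [Fintype p]
    {A : ℝ → Matrix l m ℂ} {B : ℝ → Matrix l n ℂ} {C : ℝ → Matrix p m ℂ} {D : ℝ → Matrix p n ℂ}
    {A' : Matrix l m ℂ} {B' : Matrix l n ℂ} {C' : Matrix p m ℂ} {D' : Matrix p n ℂ} {x : ℝ}
    (hA : HasDerivAt A A' x) (hB : HasDerivAt B B' x) (hC : HasDerivAt C C' x)
    (hD : HasDerivAt D D' x) :
    HasDerivAt (fun t => Matrix.fromBlocks (A t) (B t) (C t) (D t))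
      (Matrix.fromBlocks A' B' C' D') x := by
  rw [hasDerivAt_matrix_iff] at *
  rintro (i | i) (j | j)
  exacts [hA i j, hB i j, hC i j, hD i j]

/-- A `C¹` criterion, for the real normed structure that restricts the complex one. -/
theorem contDiff_one_of_hasDerivAt [DecidableEq n] {A A' : ℝ → Matrix m n ℂ}
    (h : ∀ x, HasDerivAt A (A' x) x) (hc : Continuous A') : ContDiff ℝ 1 A := by
  rw [contDiff_one_iff_deriv]
  exact ⟨fun x => (h x).differentiableAt, (funext fun x => (h x).deriv : deriv A = A') ▸ hc⟩

/-- The operator norm makes complex matrices a real normed space whose scalar multiplication is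
the entrywise one. -/
@[reducible] noncomputable def realNormedSpace [DecidableEq n] : NormedSpace ℝ (Matrix m n ℂ) where
  norm_smul_le r A := by
    have h : r • A = (r : ℂ) • A := by ext i j; simp
    rw [h, norm_smul]; simp

attribute [local instance] realNormedSpace

/-- Left multiplication by a matrix as a continuous linear map. -/
def mulLeftL [DecidableEq m] [DecidableEq n] (A : Matrix l m ℂ) :
    Matrix m n ℂ →L[ℝ] Matrix l n ℂ where
  toFun B := A * B
  map_add' := Matrix.mul_add A
  map_smul' r B := Matrix.mul_smul A r B
  cont := continuous_const.matrix_mul continuous_id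

theorem hasDerivAt_integral_Iic {E : Type*} [NormedAddCommGroup E] [NormedSpace ℝ E]
    [CompleteSpace E] {h : ℝ → E} (hc : Continuous h) (hi : ∀ x, IntegrableOn h (Iic x)) (x : ℝ) :
    HasDerivAt (fun t => ∫ y in Iic t, h y) (h x) x := by
  have e : (fun t => ∫ y in Iic t, h y) =
      fun t => (∫ y in Iic (0 : ℝ), h y) + ∫ y in (0 : ℝ)..t, h y := by
    ext t
    rw [← intervalIntegral.integral_Iic_sub_Iic (hi 0) (hi t)]; abel
  rw [e]
  exact (intervalIntegral.integral_hasDerivAt_right (hc.intervalIntegrable _ _)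
    (hc.stronglyMeasurableAtFilter _ _) hc.continuousAt).const_add _

theorem hasDerivAt_integral_Ioi {E : Type*} [NormedAddCommGroup E] [NormedSpace ℝ E]
    [CompleteSpace E] {h : ℝ → E} (hc : Continuous h) (hi : ∀ x, IntegrableOn h (Ioi x)) (x : ℝ) :
    HasDerivAt (fun t => ∫ y in Ioi t, h y) (-h x) x := by
  have e : (fun t => ∫ y in Ioi t, h y) =
      fun t => (∫ y in Ioi (0 : ℝ), h y) - ∫ y in (0 : ℝ)..t, h y := by
    ext t
    rw [← intervalIntegral.integral_Ioi_sub_Ioi' (hi 0) (hi t)]; abel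
  rw [e]
  exact (intervalIntegral.integral_hasDerivAt_right (hc.intervalIntegrable _ _)
    (hc.stronglyMeasurableAtFilter _ _) hc.continuousAt).const_sub _

/-- The kernel times the weight is a single exponential in `y`. This and the next three lemmas
produce the factors `1/(μ+κ)` and `1/(μ-κ)` of the Green operator. -/
theorem integrableOn_exp_kernel_Iic {μ κ : ℝ} (h : 0 < μ + κ) (x : ℝ) :
    IntegrableOn (fun y => Real.exp (-μ * (x - y)) * Real.exp (κ * y)) (Iic x) := by
  have e : (fun y => Real.exp (-μ * (x - y)) * Real.exp (κ * y)) =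
      fun y => Real.exp (-μ * x) * Real.exp ((μ + κ) * y) := by
    ext y; rw [← Real.exp_add, ← Real.exp_add]; ring_nf
  rw [e]; exact (integrableOn_exp_mul_Iic h x).const_mul _

theorem integral_exp_kernel_Iic {μ κ : ℝ} (h : 0 < μ + κ) (x : ℝ) :
    ∫ y in Iic x, Real.exp (-μ * (x - y)) * Real.exp (κ * y) = Real.exp (κ * x) / (μ + κ) := by
  have e : (fun y => Real.exp (-μ * (x - y)) * Real.exp (κ * y)) =
      fun y => Real.exp (-μ * x) * Real.exp ((μ + κ) * y) := by
    ext y; rw [← Real.exp_add, ← Real.exp_add]; ring_nf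
  rw [e, integral_const_mul, integral_exp_mul_Iic h, ← mul_div_assoc, ← Real.exp_add]
  ring_nf

theorem integrableOn_exp_kernel_Ioi {μ κ : ℝ} (h : 0 < μ - κ) (x : ℝ) :
    IntegrableOn (fun y => Real.exp (-μ * (y - x)) * Real.exp (κ * y)) (Ioi x) := by
  have e : (fun y => Real.exp (-μ * (y - x)) * Real.exp (κ * y)) =
      fun y => Real.exp (μ * x) * Real.exp (-(μ - κ) * y) := by
    ext y; rw [← Real.exp_add, ← Real.exp_add]; ring_nf
  rw [e]; exact (integrableOn_exp_mul_Ioi (by linarith) x).const_mul _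

theorem integral_exp_kernel_Ioi {μ κ : ℝ} (h : 0 < μ - κ) (x : ℝ) :
    ∫ y in Ioi x, Real.exp (-μ * (y - x)) * Real.exp (κ * y) = Real.exp (κ * x) / (μ - κ) := by
  have e : (fun y => Real.exp (-μ * (y - x)) * Real.exp (κ * y)) =
      fun y => Real.exp (μ * x) * Real.exp (-(μ - κ) * y) := by
    ext y; rw [← Real.exp_add, ← Real.exp_add]; ring_nf
  rw [e, integral_const_mul, integral_exp_mul_Ioi (by linarith), neg_div_neg_eq, ← mul_div_assoc,
    ← Real.exp_add]
  ring_nf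

end Calculus

/-! ### Evolution operators and the adjoint dichotomy. -/

section Evolution

attribute [local instance] realNormedSpace

variable {m n : ℕ} {M : ℝ → Matrix (Fin n) (Fin n) ℂ} {T : ℝ → ℝ → Matrix (Fin n) (Fin n) ℂ}
  {B : ℝ}

theorem eq_of_hasDerivAt_linear (hB : ∀ x, ‖M x‖ ≤ B) {V W : ℝ → Matrix (Fin n) (Fin m) ℂ}
    (hV : ∀ x, HasDerivAt V (M x * V x) x) (hW : ∀ x, HasDerivAt W (M x * W x) x) {x₀ : ℝ}
    (h : V x₀ = W x₀) : V = W := by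
  have hB0 : 0 ≤ B := (norm_nonneg _).trans (hB 0)
  refine ODE_solution_unique_univ (v := fun x V => M x * V) (s := fun _ => univ) (K := ⟨B, hB0⟩)
    (t₀ := x₀) (fun x => ?_) (fun x => ⟨hV x, mem_univ _⟩) (fun x => ⟨hW x, mem_univ _⟩) h
  refine (LipschitzWith.of_dist_le_mul fun V W => ?_).lipschitzOnWith
  rw [dist_eq_norm, dist_eq_norm, ← Matrix.mul_sub]
  exact (Matrix.l2_opNorm_mul _ _).trans
    (mul_le_mul_of_nonneg_right (hB x) (norm_nonneg _))

theorem IsEvolution.eq_mul (hT : IsEvolution M T) (hB : ∀ x, ‖M x‖ ≤ B)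
    {V : ℝ → Matrix (Fin n) (Fin m) ℂ} (hV : ∀ x, HasDerivAt V (M x * V x) x) (x y : ℝ) :
    V x = T x y * V y := by
  refine congrFun (eq_of_hasDerivAt_linear hB hV (W := fun x => T x y * V y) (fun x => ?_)
    (x₀ := y) ?_) x
  · simpa [Matrix.mul_assoc] using
      hasDerivAt_matrix_mul ((hT y).2 x) (hasDerivAt_const x (V y))
  · simp [(hT y).1]

theorem IsEvolution.mul_trans (hT : IsEvolution M T) (hB : ∀ x, ‖M x‖ ≤ B) (x y z : ℝ) :
    T x y * T y z = T x z :=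
  (hT.eq_mul hB (hT z).2 x y).symm

theorem IsEvolution.mul_symm (hT : IsEvolution M T) (hB : ∀ x, ‖M x‖ ≤ B) (x y : ℝ) :
    T x y * T y x = 1 := by
  rw [hT.mul_trans hB, (hT x).1]

theorem IsEvolution.eq_inv (hT : IsEvolution M T) (hB : ∀ x, ‖M x‖ ≤ B) (x y : ℝ) :
    T x y = (T y x)⁻¹ :=
  (Matrix.inv_eq_left_inv (hT.mul_symm hB x y)).symm

theorem IsEvolution.continuous_left (hT : IsEvolution M T) (y : ℝ) :
    Continuous fun x => T x y :=
  continuous_iff_continuousAt.2 fun x => ((hT y).2 x).continuousAt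

/-- As a function of its second argument, `T x s` is the inverse of `T s x`, so the derivative of
inversion applies. -/
theorem IsEvolution.hasDerivAt_right (hT : IsEvolution M T) (hB : ∀ x, ‖M x‖ ≤ B) (x y : ℝ) :
    HasDerivAt (fun s => T x s) (-(T x y * M y)) y := by
  have e : (fun s => T x s) = fun s => Ring.inverse (T s x) := by
    ext1 s
    rw [hT.eq_inv hB, Matrix.nonsing_inv_eq_ringInverse]
  obtain ⟨u, hu⟩ : IsUnit (T y x) := IsUnit.of_mul_eq_one _ (hT.mul_symm hB y x)
  have hinv : (↑u⁻¹ : Matrix (Fin n) (Fin n) ℂ) = T x y := by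
    exact Units.inv_eq_of_mul_eq_one_left (by rw [hu, hT.mul_symm hB])
  have h := hasFDerivAt_ringInverse (𝕜 := ℝ) u
  rw [hu] at h
  have h' := h.comp_hasDerivAt (f := fun s => T s x) y ((hT x).2 y)
  have e' : (-ContinuousLinearMap.mulLeftRight ℝ (Matrix (Fin n) (Fin n) ℂ) ↑u⁻¹ ↑u⁻¹)
      (M y * T y x) = -(T x y * M y) := by
    simp only [hinv, neg_apply, ContinuousLinearMap.mulLeftRight_apply]
    rw [Matrix.mul_assoc, Matrix.mul_assoc, hT.mul_symm hB, Matrix.mul_one]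
  rw [e'] at h'
  rw [e]
  exact h'

theorem IsEvolution.continuous_right (hT : IsEvolution M T) (hB : ∀ x, ‖M x‖ ≤ B) (x : ℝ) :
    Continuous fun y => T x y :=
  continuous_iff_continuousAt.2 fun y => (hT.hasDerivAt_right hB x y).continuousAt

/-- The adjoint system `z' = -M(x)ᴴ z` inherits an exponential dichotomy. -/
theorem HasExpDichotomy.adjoint {K μ : ℝ} (h : HasExpDichotomy M K μ) (hB : ∀ x, ‖M x‖ ≤ B) :
    HasExpDichotomy (fun x => -(M x)ᴴ) K μ := by
  obtain ⟨T, P, hT, hP, hTP, h₁, h₂⟩ := h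
  have hTP' : ∀ x y, (1 - P x) * T x y = T x y * (1 - P y) := fun x y => by
    rw [Matrix.sub_mul, Matrix.mul_sub, hTP, Matrix.one_mul, Matrix.mul_one]
  -- The adjoint evolution is `(T y x)ᴴ`. Swapping the arguments reverses the direction of decay, so
  -- the stable projection becomes `(1 - P)ᴴ`.
  refine ⟨fun x y => (T y x)ᴴ, fun x => (1 - P x)ᴴ, fun y => ⟨by simp [(hT y).1], fun x => ?_⟩,
    fun x => ?_, fun x y => ?_, fun x y hxy => ?_, fun x y hxy => ?_⟩
  · have := hasDerivAt_matrix_conjTranspose (hT.hasDerivAt_right hB y x)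
    simpa [Matrix.conjTranspose_mul] using this
  · rw [← Matrix.conjTranspose_mul, Matrix.sub_mul, Matrix.mul_sub, Matrix.mul_sub, hP]
    simp
  · rw [← Matrix.conjTranspose_mul, ← Matrix.conjTranspose_mul, hTP']
  · rw [← Matrix.conjTranspose_mul, Matrix.l2_opNorm_conjTranspose, hTP']
    exact h₂ y x hxy
  · have e : 1 - (1 - P y)ᴴ = (P y)ᴴ := by simp
    rw [e, ← Matrix.conjTranspose_mul, Matrix.l2_opNorm_conjTranspose, hTP]
    exact h₁ y x hxy

end Evolution

/-! ### Bounded solutions of linear systems with a dichotomy. -/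

section Green

attribute [local instance] realNormedSpace

variable {m n : ℕ} {M : ℝ → Matrix (Fin n) (Fin n) ℂ} {B K μ : ℝ}

theorem tendsto_exp_neg_mul_sub_atBot (hμ : 0 < μ) (K x : ℝ) :
    Tendsto (fun y => K * Real.exp (-μ * (x - y))) atBot (𝓝 0) := by
  have h : Tendsto (fun y => -μ * (x - y)) atBot atBot := by
    have e : (fun y => -μ * (x - y)) = fun y => μ * y + -μ * x := by ext y; ring
    rw [e]
    exact tendsto_atBot_add_const_right _ _ (tendsto_id.const_mul_atBot hμ)
  simpa using (Real.tendsto_exp_atBot.comp h).const_mul K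

theorem tendsto_exp_neg_mul_sub_atTop (hμ : 0 < μ) (K x : ℝ) :
    Tendsto (fun y => K * Real.exp (-μ * (y - x))) atTop (𝓝 0) := by
  have h : Tendsto (fun y => -μ * (y - x)) atTop atBot := by
    have e : (fun y => -μ * (y - x)) = fun y => -μ * y + μ * x := by ext y; ring
    rw [e]
    exact tendsto_atBot_add_const_right _ _ (tendsto_id.const_mul_atTop_of_neg (by linarith))
  simpa using (Real.tendsto_exp_atBot.comp h).const_mul K

/-- A system with an exponential dichotomy has no nonzero bounded solution. -/
theorem HasExpDichotomy.eq_zero_of_bounded (h : HasExpDichotomy M K μ) (hB : ∀ x, ‖M x‖ ≤ B)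
    (hμ : 0 < μ) {V : ℝ → Matrix (Fin n) (Fin m) ℂ} {C : ℝ} (hC : ∀ x, ‖V x‖ ≤ C)
    (hV : ∀ x, HasDerivAt V (M x * V x) x) : V = 0 := by
  obtain ⟨T, P, hT, hP, hTP, h₁, h₂⟩ := h
  have hC0 : 0 ≤ C := (norm_nonneg _).trans (hC 0)
  ext1 x
  -- `P x * V x = T x y * P y * V y` for every `y`; let `y → -∞`. The complementary part is treated
  -- with `y → +∞`.
  have hs : P x * V x = 0 := by
    refine norm_le_zero_iff.1 (ge_of_tendsto
      (tendsto_exp_neg_mul_sub_atBot hμ (C * K) x) ?_)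
    filter_upwards [eventually_le_atBot x] with y hy
    rw [hT.eq_mul hB hV x y, ← Matrix.mul_assoc, hTP]
    calc _ ≤ ‖T x y * P y‖ * ‖V y‖ := Matrix.l2_opNorm_mul _ _
      _ ≤ (K * Real.exp (-μ * (x - y))) * C :=
        mul_le_mul (h₁ x y hy) (hC y) (norm_nonneg _) ((norm_nonneg _).trans (h₁ x y hy))
      _ = _ := by ring
  have hu : (1 - P x) * V x = 0 := by
    refine norm_le_zero_iff.1 (ge_of_tendsto
      (tendsto_exp_neg_mul_sub_atTop hμ (C * K) x) ?_)
    filter_upwards [eventually_ge_atTop x] with y hy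
    have e : (1 - P x) * T x y = T x y * (1 - P y) := by
      rw [Matrix.sub_mul, Matrix.mul_sub, hTP, Matrix.one_mul, Matrix.mul_one]
    rw [hT.eq_mul hB hV x y, ← Matrix.mul_assoc, e]
    calc _ ≤ ‖T x y * (1 - P y)‖ * ‖V y‖ := Matrix.l2_opNorm_mul _ _
      _ ≤ (K * Real.exp (-μ * (y - x))) * C :=
        mul_le_mul (h₂ x y hy) (hC y) (norm_nonneg _) ((norm_nonneg _).trans (h₂ x y hy))
      _ = _ := by ring
  rw [Matrix.sub_mul, hs, sub_zero, Matrix.one_mul] at hu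
  exact hu

/-- Two bounded solutions of the same inhomogeneous system coincide. -/
theorem HasExpDichotomy.bounded_solution_unique (h : HasExpDichotomy M K μ)
    (hB : ∀ x, ‖M x‖ ≤ B) (hμ : 0 < μ) {f V W : ℝ → Matrix (Fin n) (Fin m) ℂ} {C D : ℝ}
    (hC : ∀ x, ‖V x‖ ≤ C) (hD : ∀ x, ‖W x‖ ≤ D) (hV : ∀ x, HasDerivAt V (M x * V x + f x) x)
    (hW : ∀ x, HasDerivAt W (M x * W x + f x) x) : V = W := by
  rw [← sub_eq_zero]
  refine h.eq_zero_of_bounded hB hμ (C := C + D)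
    (fun x => (norm_sub_le _ _).trans (add_le_add (hC x) (hD x))) fun x => ?_
  have e : M x * (V - W) x = (M x * V x + f x) - (M x * W x + f x) := by
    rw [Pi.sub_apply, Matrix.mul_sub]; abel
  rw [e]
  exact (hV x).sub (hW x)

/-- An inhomogeneous system with exponential dichotomy and bounded forcing has a bounded solution,
which obeys every exponential bound of rate less than `μ` that the forcing obeys. -/
theorem HasExpDichotomy.exists_bounded_solution (h : HasExpDichotomy M K μ)
    (hB : ∀ x, ‖M x‖ ≤ B) (hμ : 0 < μ) {f : ℝ → Matrix (Fin n) (Fin m) ℂ} {C : ℝ}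
    (hf : Continuous f) (hC : ∀ x, ‖f x‖ ≤ C) :
    ∃ V : ℝ → Matrix (Fin n) (Fin m) ℂ, (∀ x, HasDerivAt V (M x * V x + f x) x) ∧
      ∀ (s : Finset ℕ) (c κ : ℕ → ℝ), (∀ i ∈ s, |κ i| < μ) →
        (∀ y, ‖f y‖ ≤ ∑ i ∈ s, c i * Real.exp (κ i * y)) →
        ∀ x, ‖V x‖ ≤
          ∑ i ∈ s, K * (1 / (μ + κ i) + 1 / (μ - κ i)) * c i * Real.exp (κ i * x) := by
  obtain ⟨T, P, hT, hP, hTP, h₁, h₂⟩ := h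
  -- The definition of a dichotomy does not ask for continuity of `P`; it follows by conjugating `P
  -- 0` with the evolution.
  have hPc : Continuous P := by
    have e : P = fun x => T x 0 * P 0 * T 0 x := by
      ext1 x
      rw [← hTP, Matrix.mul_assoc, hT.mul_symm hB, Matrix.mul_one]
    rw [e]
    exact ((hT.continuous_left 0).matrix_mul continuous_const).matrix_mul
      (hT.continuous_right hB 0)
  set p : ℝ → ℝ → Matrix (Fin n) (Fin m) ℂ := fun x y => T x y * P y * f y with hp
  set q : ℝ → ℝ → Matrix (Fin n) (Fin m) ℂ := fun x y => T x y * (1 - P y) * f y with hq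
  have hpc : ∀ x, Continuous (p x) := fun x =>
    ((hT.continuous_right hB x).matrix_mul hPc).matrix_mul hf
  have hqc : ∀ x, Continuous (q x) := fun x =>
    ((hT.continuous_right hB x).matrix_mul (continuous_const.sub hPc)).matrix_mul hf
  have hpb : ∀ x, ∀ y ∈ Iic x, ∀ b, ‖f y‖ ≤ b → ‖p x y‖ ≤ K * Real.exp (-μ * (x - y)) * b :=
    fun x y hy b hb => (Matrix.l2_opNorm_mul _ _).trans
      (mul_le_mul (h₁ x y hy) hb (norm_nonneg _) ((norm_nonneg _).trans (h₁ x y hy)))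
  have hqb : ∀ x, ∀ y ∈ Ioi x, ∀ b, ‖f y‖ ≤ b → ‖q x y‖ ≤ K * Real.exp (-μ * (y - x)) * b :=
    fun x y hy b hb => (Matrix.l2_opNorm_mul _ _).trans
      (mul_le_mul (h₂ x y (le_of_lt hy)) hb (norm_nonneg _)
        ((norm_nonneg _).trans (h₂ x y (le_of_lt hy))))
  have hpT : ∀ x z y, T x z * p z y = p x y := fun x z y => by
    simp only [hp, ← Matrix.mul_assoc, hT.mul_trans hB]
  have hqT : ∀ x z y, T x z * q z y = q x y := fun x z y => by
    simp only [hq, ← Matrix.mul_assoc, hT.mul_trans hB]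
  have hpi' : ∀ x, IntegrableOn (p x) (Iic x) := fun x => by
    refine Integrable.mono' (((integrableOn_exp_kernel_Iic (μ := μ) (κ := 0)
      (by linarith) x).const_mul (K * C))) (hpc x).aestronglyMeasurable
      ((ae_restrict_iff' measurableSet_Iic).2 (ae_of_all _ fun y hy => ?_))
    refine (hpb x y hy C (hC y)).trans (le_of_eq ?_)
    simp only [zero_mul, Real.exp_zero]; ring
  have hqi' : ∀ x, IntegrableOn (q x) (Ioi x) := fun x => by
    refine Integrable.mono' (((integrableOn_exp_kernel_Ioi (μ := μ) (κ := 0)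
      (by linarith) x).const_mul (K * C))) (hqc x).aestronglyMeasurable
      ((ae_restrict_iff' measurableSet_Ioi).2 (ae_of_all _ fun y hy => ?_))
    refine (hqb x y hy C (hC y)).trans (le_of_eq ?_)
    simp only [zero_mul, Real.exp_zero]; ring
  -- The decay estimate controls `p x` on `Iic x`; applying `T 0 x` transfers integrability to `p
  -- 0`.
  have hpi : ∀ x, IntegrableOn (p 0) (Iic x) := fun x => by
    have := (mulLeftL (n := Fin m) (T 0 x)).integrable_comp (hpi' x)
    exact this.congr (ae_of_all _ fun y => hpT 0 x y)
  have hqi : ∀ x, IntegrableOn (q 0) (Ioi x) := fun x => by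
    have := (mulLeftL (n := Fin m) (T 0 x)).integrable_comp (hqi' x)
    exact this.congr (ae_of_all _ fun y => hqT 0 x y)
  have hpe : ∀ x, T x 0 * ∫ y in Iic x, p 0 y = ∫ y in Iic x, p x y := fun x => by
    refine ((mulLeftL (n := Fin m) (T x 0)).integral_comp_comm (hpi x)).symm.trans ?_
    exact integral_congr_ae (ae_of_all _ fun y => hpT x 0 y)
  have hqe : ∀ x, T x 0 * ∫ y in Ioi x, q 0 y = ∫ y in Ioi x, q x y := fun x => by
    refine ((mulLeftL (n := Fin m) (T x 0)).integral_comp_comm (hqi x)).symm.trans ?_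
    exact integral_congr_ae (ae_of_all _ fun y => hqT x 0 y)
  -- Basing the integrands at `0` takes `x` out of them, so the product rule and the fundamental
  -- theorem of calculus suffice. The boundary terms add up to `P x * f x + (1 - P x) * f x = f x`.
  refine ⟨fun x => T x 0 * ((∫ y in Iic x, p 0 y) - ∫ y in Ioi x, q 0 y), fun x => ?_, ?_⟩
  · have hd := hasDerivAt_matrix_mul ((hT 0).2 x)
      ((hasDerivAt_integral_Iic (hpc 0) hpi x).sub (hasDerivAt_integral_Ioi (hqc 0) hqi x))
    have e : M x * T x 0 * ((∫ y in Iic x, p 0 y) - ∫ y in Ioi x, q 0 y) +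
        T x 0 * (p 0 x - -q 0 x) =
        M x * (T x 0 * ((∫ y in Iic x, p 0 y) - ∫ y in Ioi x, q 0 y)) + f x := by
      rw [sub_neg_eq_add, Matrix.mul_add, hpT, hqT, Matrix.mul_assoc]
      simp only [hp, hq, (hT x).1, Matrix.one_mul, ← Matrix.add_mul, add_sub_cancel]
    rw [← e]
    exact hd
  · intro s c κ hκ hfb x
    have hIic : ∀ i ∈ s, IntegrableOn (fun y => K * c i *
        (Real.exp (-μ * (x - y)) * Real.exp (κ i * y))) (Iic x) := fun i hi =>
      (integrableOn_exp_kernel_Iic (by linarith [(abs_lt.1 (hκ i hi)).1]) x).const_mul _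
    have hIoi : ∀ i ∈ s, IntegrableOn (fun y => K * c i *
        (Real.exp (-μ * (y - x)) * Real.exp (κ i * y))) (Ioi x) := fun i hi =>
      (integrableOn_exp_kernel_Ioi (by linarith [(abs_lt.1 (hκ i hi)).2]) x).const_mul _
    have b₁ : ‖∫ y in Iic x, p x y‖ ≤
        ∑ i ∈ s, K * c i * (Real.exp (κ i * x) / (μ + κ i)) := by
      refine (norm_integral_le_of_norm_le (integrable_finsetSum s hIic)
        ((ae_restrict_iff' measurableSet_Iic).2 (ae_of_all _ fun y hy => ?_))).trans (le_of_eq ?_)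
      · refine (hpb x y hy _ (hfb y)).trans (le_of_eq ?_)
        rw [Finset.mul_sum]
        exact Finset.sum_congr rfl fun i _ => by ring
      · rw [integral_finsetSum s hIic]
        refine Finset.sum_congr rfl fun i hi => ?_
        rw [integral_const_mul, integral_exp_kernel_Iic (by linarith [(abs_lt.1 (hκ i hi)).1])]
    have b₂ : ‖∫ y in Ioi x, q x y‖ ≤
        ∑ i ∈ s, K * c i * (Real.exp (κ i * x) / (μ - κ i)) := by
      refine (norm_integral_le_of_norm_le (integrable_finsetSum s hIoi)
        ((ae_restrict_iff' measurableSet_Ioi).2 (ae_of_all _ fun y hy => ?_))).trans (le_of_eq ?_)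
      · refine (hqb x y hy _ (hfb y)).trans (le_of_eq ?_)
        rw [Finset.mul_sum]
        exact Finset.sum_congr rfl fun i _ => by ring
      · rw [integral_finsetSum s hIoi]
        refine Finset.sum_congr rfl fun i hi => ?_
        rw [integral_const_mul, integral_exp_kernel_Ioi (by linarith [(abs_lt.1 (hκ i hi)).2])]
    beta_reduce
    rw [Matrix.mul_sub, hpe, hqe]
    refine ((norm_sub_le _ _).trans (add_le_add b₁ b₂)).trans (le_of_eq ?_)
    rw [← Finset.sum_add_distrib]
    exact Finset.sum_congr rfl fun i _ => by ring

/-- A bounded solution of an inhomogeneous system with exponential dichotomy obeys every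
exponential bound of rate less than `μ` that the forcing obeys. -/
theorem HasExpDichotomy.norm_le_sum_exp (h : HasExpDichotomy M K μ)
    (hB : ∀ x, ‖M x‖ ≤ B) (hμ : 0 < μ) {f V : ℝ → Matrix (Fin n) (Fin m) ℂ} {C D : ℝ}
    (hf : Continuous f) (hC : ∀ x, ‖f x‖ ≤ C) (hD : ∀ x, ‖V x‖ ≤ D)
    (hV : ∀ x, HasDerivAt V (M x * V x + f x) x) (s : Finset ℕ) (c κ : ℕ → ℝ)
    (hκ : ∀ i ∈ s, |κ i| < μ) (hfb : ∀ y, ‖f y‖ ≤ ∑ i ∈ s, c i * Real.exp (κ i * y)) (x : ℝ) :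
    ‖V x‖ ≤ ∑ i ∈ s, K * (1 / (μ + κ i) + 1 / (μ - κ i)) * c i * Real.exp (κ i * x) := by
  obtain ⟨W, hW, hWb⟩ := h.exists_bounded_solution hB hμ hf hC
  have hWD : ∀ x, ‖W x‖ ≤ K * (1 / μ + 1 / μ) * C := fun x => by
    simpa using hWb {0} (fun _ => C) (fun _ => 0) (by simpa using hμ) (by simpa using hC) x
  -- By uniqueness the given bounded solution is the Green solution and inherits its bounds.
  rw [h.bounded_solution_unique hB hμ hD hWD hV hW]
  exact hWb s c κ hκ hfb x

/-- The constant weight `κ = 0`: each of the two half-line integrals contributes `K / μ`. -/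
theorem HasExpDichotomy.norm_le (h : HasExpDichotomy M K μ)
    (hB : ∀ x, ‖M x‖ ≤ B) (hμ : 0 < μ) {f V : ℝ → Matrix (Fin n) (Fin m) ℂ} {C D : ℝ}
    (hf : Continuous f) (hC : ∀ x, ‖f x‖ ≤ C) (hD : ∀ x, ‖V x‖ ≤ D)
    (hV : ∀ x, HasDerivAt V (M x * V x + f x) x) (x : ℝ) : ‖V x‖ ≤ 2 * K / μ * C := by
  have := h.norm_le_sum_exp hB hμ hf hC hD hV {0} (fun _ => C) (fun _ => 0)
    (by simpa using hμ) (by simpa using hC) x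
  refine this.trans (le_of_eq ?_)
  simp only [Finset.sum_singleton, add_zero, sub_zero, zero_mul, Real.exp_zero]; ring

theorem HasExpDichotomy.exists_bounded_solution_norm_le (h : HasExpDichotomy M K μ)
    (hB : ∀ x, ‖M x‖ ≤ B) (hμ : 0 < μ) {f : ℝ → Matrix (Fin n) (Fin m) ℂ} {C : ℝ}
    (hf : Continuous f) (hC : ∀ x, ‖f x‖ ≤ C) :
    ∃ V : ℝ → Matrix (Fin n) (Fin m) ℂ, (∀ x, HasDerivAt V (M x * V x + f x) x) ∧
      ∀ x, ‖V x‖ ≤ 2 * K / μ * C := by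
  obtain ⟨V, hV, hVb⟩ := h.exists_bounded_solution hB hμ hf hC
  refine ⟨V, hV, fun x => (hVb {0} (fun _ => C) (fun _ => 0)
    (by simpa using hμ) (by simpa using hC) x).trans (le_of_eq ?_)⟩
  simp only [Finset.sum_singleton, add_zero, sub_zero, zero_mul, Real.exp_zero]; ring

end Green

/-! ### Small Lipschitz perturbations of a dichotomy. -/

section Semilinear

variable {m n : ℕ} {M : ℝ → Matrix (Fin n) (Fin n) ℂ} {B K μ q R : ℝ}
  {N : ℝ → Matrix (Fin n) (Fin m) ℂ → Matrix (Fin n) (Fin m) ℂ}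

/-- A semilinear system whose nonlinearity is a small Lipschitz perturbation of a system with
exponential dichotomy has a solution in a ball that the nonlinearity preserves. -/
theorem HasExpDichotomy.exists_semilinear (h : HasExpDichotomy M K μ)
    (hB : ∀ x, ‖M x‖ ≤ B) (hK : 0 < K) (hμ : 0 < μ) (hR : 0 ≤ R)
    (hN : Continuous fun z : ℝ × Matrix (Fin n) (Fin m) ℂ => N z.1 z.2)
    (hq0 : 0 ≤ q) (hq : 2 * K / μ * q < 1)
    (hlip : ∀ x v w, ‖v‖ ≤ R → ‖w‖ ≤ R → ‖N x v - N x w‖ ≤ q * ‖v - w‖)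
    (hball : ∀ x v, ‖v‖ ≤ R → 2 * K / μ * ‖N x v‖ ≤ R) :
    ∃ V : ℝ → Matrix (Fin n) (Fin m) ℂ, (∀ x, ‖V x‖ ≤ R) ∧
      ∀ x, HasDerivAt V (M x * V x + N x (V x)) x := by
  have hKμ : 0 < 2 * K / μ := by positivity
  have hNb : ∀ x v, ‖v‖ ≤ R → ‖N x v‖ ≤ R / (2 * K / μ) := fun x v hv => by
    rw [le_div_iff₀ hKμ, mul_comm]; exact hball x v hv
  have hNc : ∀ V : ℝ →ᵇ Matrix (Fin n) (Fin m) ℂ, Continuous fun x => N x (V x) := fun V =>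
    hN.comp (continuous_id.prodMk V.continuous)
  have key : ∀ V : ℝ →ᵇ Matrix (Fin n) (Fin m) ℂ, ∃ W : ℝ →ᵇ Matrix (Fin n) (Fin m) ℂ,
      ‖V‖ ≤ R → ‖W‖ ≤ R ∧ ∀ x, HasDerivAt W (M x * W x + N x (V x)) x := by
    intro V
    by_cases hV : ‖V‖ ≤ R
    · obtain ⟨W, hW, hWb⟩ := h.exists_bounded_solution_norm_le hB hμ (hNc V)
        fun x => hNb x _ ((V.norm_coe_le_norm x).trans hV)
      rw [mul_div_cancel₀ _ hKμ.ne'] at hWb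
      refine ⟨BoundedContinuousFunction.ofNormedAddCommGroup W
        (continuous_iff_continuousAt.2 fun x => (hW x).continuousAt) R hWb, fun _ =>
        ⟨BoundedContinuousFunction.norm_ofNormedAddCommGroup_le _ hR hWb, hW⟩⟩
    · exact ⟨0, fun hV' => absurd hV' hV⟩
  choose Γ hΓ using key
  have hmaps : MapsTo Γ (Metric.closedBall 0 R) (Metric.closedBall 0 R) := fun V hV => by
    rw [mem_closedBall_zero_iff] at *
    exact (hΓ V hV).1
  have hcontr : ContractingWith ⟨2 * K / μ * q, by positivity⟩ (hmaps.restrict Γ _ _) := by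
    refine ⟨hq, LipschitzWith.of_dist_le_mul fun V W => ?_⟩
    obtain ⟨V, hV⟩ := V
    obtain ⟨W, hW⟩ := W
    have hV' := mem_closedBall_zero_iff.1 hV
    have hW' := mem_closedBall_zero_iff.1 hW
    rw [Subtype.dist_eq, Subtype.dist_eq]
    change dist (Γ V) (Γ W) ≤ 2 * K / μ * q * dist V W
    rw [dist_eq_norm, dist_eq_norm, BoundedContinuousFunction.norm_le (by positivity)]
    intro x
    -- The difference of two images is a bounded solution of the linear system forced by the
    -- difference of the nonlinearities.
    rw [mul_assoc]
    refine h.norm_le hB hμ (f := fun x => N x (V x) - N x (W x)) (V := ⇑(Γ V - Γ W))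
      ((hNc V).sub (hNc W)) (fun y => ?_)
      (fun y => BoundedContinuousFunction.norm_coe_le_norm (Γ V - Γ W) y) (fun y => ?_) x
    · refine (hlip y _ _ ((V.norm_coe_le_norm y).trans hV')
        ((W.norm_coe_le_norm y).trans hW')).trans ?_
      exact mul_le_mul_of_nonneg_left ((V - W).norm_coe_le_norm y) hq0
    · have e : M y * (Γ V - Γ W) y + (N y (V y) - N y (W y)) =
          (M y * Γ V y + N y (V y)) - (M y * Γ W y + N y (W y)) := by
        rw [BoundedContinuousFunction.coe_sub, Pi.sub_apply, Matrix.mul_sub]; abel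
      rw [e]
      exact ((hΓ V hV').2 y).sub ((hΓ W hW').2 y)
  obtain ⟨V, hVR, hVfix, -⟩ := hcontr.exists_fixedPoint' Metric.isClosed_closedBall.isComplete
    hmaps (x := 0) (by simpa using hR) (edist_ne_top _ _)
  rw [mem_closedBall_zero_iff] at hVR
  refine ⟨V, fun x => (V.norm_coe_le_norm x).trans hVR, fun x => ?_⟩
  have := (hΓ V hVR).2 x
  rwa [hVfix.eq] at this

/-- The solution of the semilinear system in the ball is unique. -/
theorem HasExpDichotomy.semilinear_unique (h : HasExpDichotomy M K μ)
    (hB : ∀ x, ‖M x‖ ≤ B) (hμ : 0 < μ)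
    (hN : Continuous fun z : ℝ × Matrix (Fin n) (Fin m) ℂ => N z.1 z.2)
    (hq0 : 0 ≤ q) (hq : 2 * K / μ * q < 1)
    (hlip : ∀ x v w, ‖v‖ ≤ R → ‖w‖ ≤ R → ‖N x v - N x w‖ ≤ q * ‖v - w‖)
    {V W : ℝ → Matrix (Fin n) (Fin m) ℂ} (hVR : ∀ x, ‖V x‖ ≤ R) (hWR : ∀ x, ‖W x‖ ≤ R)
    (hV : ∀ x, HasDerivAt V (M x * V x + N x (V x)) x)
    (hW : ∀ x, HasDerivAt W (M x * W x + N x (W x)) x) : V = W := by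
  have hVc : Continuous V := continuous_iff_continuousAt.2 fun x => (hV x).continuousAt
  have hWc : Continuous W := continuous_iff_continuousAt.2 fun x => (hW x).continuousAt
  have hbdd : BddAbove (range fun x => ‖V x - W x‖) :=
    ⟨R + R, by
      rintro _ ⟨x, rfl⟩
      exact (norm_sub_le _ _).trans (add_le_add (hVR x) (hWR x))⟩
  set s := ⨆ x, ‖V x - W x‖ with hs
  have hle : ∀ x, ‖V x - W x‖ ≤ s := fun x => le_ciSup hbdd x
  have hstep : ∀ x, ‖V x - W x‖ ≤ 2 * K / μ * (q * s) := by
    refine h.norm_le hB hμ (f := fun x => N x (V x) - N x (W x))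
      ((hN.comp (continuous_id.prodMk hVc)).sub (hN.comp (continuous_id.prodMk hWc)))
      (fun y => (hlip y _ _ (hVR y) (hWR y)).trans (mul_le_mul_of_nonneg_left (hle y) hq0)) hle
      (fun y => ?_)
    have e : M y * (V y - W y) + (N y (V y) - N y (W y)) =
        (M y * V y + N y (V y)) - (M y * W y + N y (W y)) := by
      rw [Matrix.mul_sub]; abel
    rw [e]
    exact (hV y).sub (hW y)
  -- The supremum `s` of the difference is at most a factor less than `1` times itself, hence is not
  -- positive.
  have hs' : s ≤ 2 * K / μ * (q * s) := ciSup_le hstep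
  have hs0 : s ≤ 0 := by
    by_contra! hpos
    nlinarith
  ext1 x
  exact sub_eq_zero.1 (norm_le_zero_iff.1 ((hle x).trans hs0))

end Semilinear

/-! ### The local estimate by exponential weights. -/

section LocalEstimate

variable {m n : ℕ} {M : ℝ → Matrix (Fin n) (Fin n) ℂ} {B K μ : ℝ}

/-- If the forcing of a system with exponential dichotomy is bounded by a small multiple of the
solution plus `g`, then a bounded solution at `x` is controlled by `g` on `[x - a, x + a]`, up to an
exponentially small error. -/
theorem HasExpDichotomy.local_norm_le (h : HasExpDichotomy M K μ)
    (hB : ∀ x, ‖M x‖ ≤ B) (hK : 0 < K) (hμ : 0 < μ) {f V : ℝ → Matrix (Fin n) (Fin m) ℂ}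
    {g : ℝ → ℝ} {C D q c₁ c₂ a x : ℝ}
    (hf : Continuous f) (hC : ∀ y, ‖f y‖ ≤ C) (hD : ∀ y, ‖V y‖ ≤ D)
    (hV : ∀ y, HasDerivAt V (M y * V y + f y) y)
    (hq0 : 0 ≤ q) (hq : 8 * K / μ * q ≤ 1) (hfg : ∀ y, ‖f y‖ ≤ q * ‖V y‖ + g y)
    (hc₁ : 0 ≤ c₁) (hc₂ : 0 < c₂) (hg₁ : ∀ y ∈ Icc (x - a) (x + a), g y ≤ c₁)
    (hg₂ : ∀ y, g y ≤ c₂) :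
    ‖V x‖ ≤ 4 * K / μ * (c₁ + 2 * c₂ * Real.exp (-a * μ / 2)) := by
  set d := c₂ * Real.exp (-a * μ / 2) with hd
  have hd0 : 0 < d := by positivity
  -- The weight `b` dominates `g` everywhere: `c₁` does so on the window, and outside it one of the
  -- exponentials is at least `exp (a * μ / 2)`, which cancels the small factor in `d`.
  set b : ℝ → ℝ := fun y =>
    c₁ + d * (Real.exp (μ / 2 * (y - x)) + Real.exp (-(μ / 2) * (y - x))) with hb
  have hdb : ∀ y, d ≤ b y := fun y => by
    have h1 : 1 ≤ Real.exp (μ / 2 * (y - x)) + Real.exp (-(μ / 2) * (y - x)) := by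
      rcases le_total x y with hxy | hxy
      · have : 1 ≤ Real.exp (μ / 2 * (y - x)) :=
          Real.one_le_exp (mul_nonneg (by positivity) (by linarith))
        linarith [Real.exp_pos (-(μ / 2) * (y - x))]
      · have : 1 ≤ Real.exp (-(μ / 2) * (y - x)) :=
          Real.one_le_exp (mul_nonneg_of_nonpos_of_nonpos (by linarith) (by linarith))
        linarith [Real.exp_pos (μ / 2 * (y - x))]
    have := le_mul_of_one_le_right hd0.le h1
    simp only [hb]; linarith
  have hbpos : ∀ y, 0 < b y := fun y => hd0.trans_le (hdb y)
  have hgb : ∀ y, g y ≤ b y := fun y => by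
    have p₁ : 0 < d * Real.exp (μ / 2 * (y - x)) := by positivity
    have p₂ : 0 < d * Real.exp (-(μ / 2) * (y - x)) := by positivity
    simp only [hb, mul_add]
    by_cases hy : y ∈ Icc (x - a) (x + a)
    · linarith [hg₁ y hy]
    · have hcase : x + a < y ∨ y < x - a := by
        by_contra! hcon
        exact hy ⟨hcon.2, hcon.1⟩
      rcases hcase with hy | hy
      · have : c₂ ≤ d * Real.exp (μ / 2 * (y - x)) := by
          rw [hd, mul_assoc, ← Real.exp_add]
          exact le_mul_of_one_le_right hc₂.le (Real.one_le_exp (by nlinarith))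
        linarith [hg₂ y]
      · have : c₂ ≤ d * Real.exp (-(μ / 2) * (y - x)) := by
          rw [hd, mul_assoc, ← Real.exp_add]
          exact le_mul_of_one_le_right hc₂.le (Real.one_le_exp (by nlinarith))
        linarith [hg₂ y]
  -- The weighted supremum `s` is finite because `V` is bounded and `b ≥ d > 0`.
  have hbdd : BddAbove (range fun y => ‖V y‖ / b y) := by
    refine ⟨D / d, ?_⟩
    rintro _ ⟨y, rfl⟩
    exact div_le_div₀ ((norm_nonneg _).trans (hD y)) (hD y) hd0 (hdb y)
  set s := ⨆ y, ‖V y‖ / b y with hs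
  have hVs : ∀ y, ‖V y‖ ≤ s * b y := fun y => (div_le_iff₀ (hbpos y)).1 (le_ciSup hbdd y)
  have hs0 : 0 ≤ s := by
    have := (norm_nonneg _).trans (hVs x)
    exact nonneg_of_mul_nonneg_left this (hbpos x)
  set t := q * s + 1 with ht
  have ht0 : 0 < t := by positivity
  have hft : ∀ y, ‖f y‖ ≤ t * b y := fun y => by
    have := mul_le_mul_of_nonneg_left (hVs y) hq0
    have := hfg y
    have := hgb y
    rw [ht]; linarith
  have hVt : ∀ y, ‖V y‖ ≤ 8 * K / (3 * μ) * t * b y := by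
    intro y
    -- Indices `0, 1, 2` are the terms of `t * b` with rates `0`, `μ/2`, `-μ/2`. The factors `exp (∓
    -- μ x / 2)` recentre at `x` the weights, which the linear estimate centres at `0`.
    have hkey := h.norm_le_sum_exp hB hμ hf hC hD hV (Finset.range 3)
      (fun i => if i = 0 then t * c₁ else if i = 1 then t * d * Real.exp (-(μ / 2 * x))
        else t * d * Real.exp (μ / 2 * x))
      (fun i => if i = 0 then 0 else if i = 1 then μ / 2 else -(μ / 2)) ?_ ?_ y
    · refine hkey.trans ?_
      simp only [Finset.sum_range_succ, Finset.sum_range_zero, one_ne_zero, if_true, if_false,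
        OfNat.ofNat_ne_zero, OfNat.ofNat_ne_one, zero_add, zero_mul, Real.exp_zero, add_zero,
        sub_zero, mul_one]
      have e₁ : Real.exp (μ / 2 * (y - x)) = Real.exp (-(μ / 2 * x)) * Real.exp (μ / 2 * y) := by
        rw [← Real.exp_add]; ring_nf
      have e₂ : Real.exp (-(μ / 2) * (y - x)) = Real.exp (μ / 2 * x) * Real.exp (-(μ / 2) * y) := by
        rw [← Real.exp_add]; ring_nf
      -- At rates `±μ/2` the Green factor is `8K/(3μ)`; the factor `2K/μ` at rate `0` is smaller.
      have e₃ : K * (1 / (μ + μ / 2) + 1 / (μ - μ / 2)) = 8 * K / (3 * μ) := by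
        rw [show μ + μ / 2 = 3 * μ / 2 by ring, show μ - μ / 2 = μ / 2 by ring]
        field_simp; norm_num
      have e₄ : K * (1 / (μ + -(μ / 2)) + 1 / (μ - -(μ / 2))) = 8 * K / (3 * μ) := by
        rw [← e₃]; ring_nf
      have e₅ : K * (1 / μ + 1 / μ) ≤ 8 * K / (3 * μ) := by
        rw [show K * (1 / μ + 1 / μ) = 6 * K / (3 * μ) by field_simp; norm_num]
        gcongr; norm_num
      have := mul_le_mul_of_nonneg_right e₅ (mul_nonneg ht0.le hc₁)
      rw [e₃, e₄]
      simp only [hb, e₁, e₂]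
      linarith
    · intro i _
      split_ifs
      · simpa using hμ
      · rw [abs_of_pos (by positivity)]; linarith
      · rw [abs_neg, abs_of_pos (by positivity)]; linarith
    · intro y
      refine (hft y).trans (le_of_eq ?_)
      simp only [Finset.sum_range_succ, Finset.sum_range_zero, one_ne_zero, if_true, if_false,
        OfNat.ofNat_ne_zero, OfNat.ofNat_ne_one, zero_add, zero_mul, Real.exp_zero, mul_one]
      have e₁ : Real.exp (μ / 2 * (y - x)) = Real.exp (-(μ / 2 * x)) * Real.exp (μ / 2 * y) := by
        rw [← Real.exp_add]; ring_nf
      have e₂ : Real.exp (-(μ / 2) * (y - x)) = Real.exp (μ / 2 * x) * Real.exp (-(μ / 2) * y) := by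
        rw [← Real.exp_add]; ring_nf
      simp only [hb, e₁, e₂]
      ring
  have hst : s ≤ 8 * K / (3 * μ) * t := ciSup_le fun y => (div_le_iff₀ (hbpos y)).2 (hVt y)
  -- With `8Kq/μ ≤ 1`, the inequality `s ≤ 8K/(3μ) * (q s + 1)` becomes `s ≤ s/3 + 8K/(3μ)`, so `s ≤
  -- 4K/μ`.
  have hs4 : s ≤ 4 * K / μ := by
    have e₁ : 8 * K / (3 * μ) * t = (8 * K / μ * q) * s / 3 + 2 / 3 * (4 * K / μ) := by
      rw [ht]; field_simp; ring
    have := mul_le_mul_of_nonneg_right hq hs0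
    linarith
  have hbx : b x = c₁ + 2 * c₂ * Real.exp (-a * μ / 2) := by
    simp only [hb, hd, sub_self, mul_zero, Real.exp_zero]; ring
  rw [← hbx]
  exact (hVs x).trans (mul_le_mul_of_nonneg_right hs4 (hbpos x).le)

end LocalEstimate

/-! ### Block diagonalization. -/

section Transform

/-- The equation for `H` gives `(H w)' - M H w = H (w' - N w)`, and `H` is injective. The derivative
of `G` serves only to show that `w = G (H w)` is differentiable when `H w` is. -/
theorem transforms_of_hasDerivAt {ι : Type} [Fintype ι] [DecidableEq ι]
    {H G G' M N : ℝ → Matrix ι ι ℂ} (hGH : ∀ x, G x * H x = 1)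
    (hH : ∀ x, HasDerivAt H (M x * H x - H x * N x) x) (hG : ∀ x, HasDerivAt G (G' x) x) :
    Transforms H M N := by
  have hHw : ∀ (w : ℝ → ι → ℂ) (w' : ι → ℂ) (x : ℝ), HasDerivAt w w' x →
      HasDerivAt (fun x => H x *ᵥ w x) (M x *ᵥ (H x *ᵥ w x) + H x *ᵥ (w' - N x *ᵥ w x)) x := by
    intro w w' x hw
    convert hasDerivAt_matrix_mulVec (hH x) hw using 1
    rw [Matrix.sub_mulVec, Matrix.mulVec_sub, Matrix.mulVec_mulVec, Matrix.mulVec_mulVec]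
    abel
  refine ⟨fun x => IsUnit.of_mul_eq_one_right _ (hGH x), fun w => ⟨fun hw x => ?_, fun hz x => ?_⟩⟩
  · simpa using hHw w _ x (hw x)
  · have e : w = fun x => G x *ᵥ (H x *ᵥ w x) := by
      ext1 x
      rw [Matrix.mulVec_mulVec, hGH, Matrix.one_mulVec]
    obtain ⟨w', hw⟩ : ∃ w', HasDerivAt w w' x := by
      rw [e]
      exact ⟨_, hasDerivAt_matrix_mulVec (hG x) (hz x)⟩
    have hu := (hHw w w' x hw).unique (hz x)
    have h0 : H x *ᵥ (w' - N x *ᵥ w x) = 0 := by simpa using hu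
    have h1 := congrArg (fun v => G x *ᵥ v) h0
    simp only [Matrix.mulVec_mulVec, hGH, Matrix.one_mulVec, Matrix.mulVec_zero] at h1
    rwa [sub_eq_zero.1 h1] at hw

variable {n₁ n₂ : ℕ} {ε : ℝ}
  {A₁₁ : ℝ → Matrix (Fin n₁) (Fin n₁) ℂ} {A₁₂ : ℝ → Matrix (Fin n₁) (Fin n₂) ℂ}
  {A₂₁ : ℝ → Matrix (Fin n₂) (Fin n₁) ℂ} {A₂₂ : ℝ → Matrix (Fin n₂) (Fin n₂) ℂ}
  {U : ℝ → Matrix (Fin n₂) (Fin n₁) ℂ} {S : ℝ → Matrix (Fin n₁) (Fin n₂) ℂ}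

theorem IsRiccatiPair.transforms (h : IsRiccatiPair ε A₁₁ A₁₂ A₂₁ A₂₂ U S) :
    Transforms (riccatiTransform ε U S) (coupled ε A₁₁ A₁₂ A₂₁ A₂₂)
      (decoupled ε A₁₁ A₁₂ A₂₂ U) := by
  obtain ⟨-, -, hU, hS⟩ := h
  -- `H` is the product of the unipotent block matrices with off-diagonal entries `U` (lower left)
  -- and `-ε S` (upper right); `G` is the product of their inverses in reverse order.
  refine transforms_of_hasDerivAt
    (G := fun x => Matrix.fromBlocks (1 - (ε : ℂ) • (S x * U x)) ((ε : ℂ) • S x) (-U x) 1)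
    (fun x => ?_) (fun x => ?_) (fun x => hasDerivAt_matrix_fromBlocks
      (((hasDerivAt_matrix_mul (hS x) (hU x)).const_smul (ε : ℂ)).const_sub 1)
      ((hS x).const_smul (ε : ℂ)) (hU x).neg (hasDerivAt_const x 1))
  · rw [riccatiTransform, Matrix.fromBlocks_multiply, ← Matrix.fromBlocks_one]
    congr 1
    · simp
    · simp only [Matrix.sub_mul, Matrix.mul_sub, Matrix.one_mul, Matrix.mul_one, Matrix.mul_neg,
        Matrix.mul_smul, Matrix.smul_mul, Matrix.mul_assoc]
      module
    · simp
    · simp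
  · have hd := hasDerivAt_matrix_fromBlocks (hasDerivAt_const x (1 : Matrix (Fin n₁) (Fin n₁) ℂ))
      ((hS x).const_smul (ε : ℂ)).neg (hU x)
      (((hasDerivAt_matrix_mul (hU x) (hS x)).const_smul (ε : ℂ)).const_sub 1)
    convert hd using 1
    · rfl
    rw [sub_eq_iff_eq_add, riccatiTransform, coupled, decoupled, Matrix.fromBlocks_multiply,
      Matrix.fromBlocks_multiply, Matrix.fromBlocks_add]
    simp only [Matrix.sub_mul, Matrix.mul_sub, Matrix.one_mul, Matrix.mul_one, Matrix.mul_neg,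
      Matrix.neg_mul, Matrix.add_mul, Matrix.mul_add, Matrix.mul_zero,
      Matrix.mul_smul, Matrix.smul_mul, Matrix.mul_assoc, smul_add, smul_sub]
    congr 1 <;> module

end Transform

/-! ### Solving the Riccati equations. -/

section Riccati

theorem norm_mul_le_of_le {l m n : Type*} [Fintype l] [Fintype m] [Fintype n] [DecidableEq m]
    [DecidableEq n] {A : Matrix l m ℂ} {B : Matrix m n ℂ} {a b : ℝ} (hA : ‖A‖ ≤ a)
    (hB : ‖B‖ ≤ b) : ‖A * B‖ ≤ a * b :=
  (Matrix.l2_opNorm_mul A B).trans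
    (mul_le_mul hA hB (norm_nonneg _) ((norm_nonneg _).trans hA))

theorem norm_ofReal_smul_le {m n : Type*} [Fintype m] [Fintype n] [DecidableEq n] {ε a : ℝ}
    (hε : 0 ≤ ε) {A : Matrix m n ℂ} (hA : ‖A‖ ≤ a) : ‖(ε : ℂ) • A‖ ≤ ε * a := by
  rw [norm_smul, Complex.norm_of_nonneg hε]
  exact mul_le_mul_of_nonneg_left hA hε

variable {n₁ n₂ : ℕ}

/-- The right-hand side of the Riccati equation for `U` without the term `A₂₂ U`. -/
noncomputable def riccatiForcing (ε : ℝ) (A₁₁ : ℝ → Matrix (Fin n₁) (Fin n₁) ℂ)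
    (A₁₂ : ℝ → Matrix (Fin n₁) (Fin n₂) ℂ) (A₂₁ : ℝ → Matrix (Fin n₂) (Fin n₁) ℂ)
    (x : ℝ) (u : Matrix (Fin n₂) (Fin n₁) ℂ) : Matrix (Fin n₂) (Fin n₁) ℂ :=
  A₂₁ x - (ε : ℂ) • (u * A₁₁ x) - (ε : ℂ) • (u * A₁₂ x * u)

/-- The right-hand side of the equation for `Sᴴ` without the term `-A₂₂ᴴ Sᴴ`. -/
noncomputable def adjointForcing (ε : ℝ) (A₁₁ : ℝ → Matrix (Fin n₁) (Fin n₁) ℂ)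
    (A₁₂ : ℝ → Matrix (Fin n₁) (Fin n₂) ℂ) (U : ℝ → Matrix (Fin n₂) (Fin n₁) ℂ)
    (x : ℝ) (z : Matrix (Fin n₂) (Fin n₁) ℂ) : Matrix (Fin n₂) (Fin n₁) ℂ :=
  (ε : ℂ) • (z * (A₁₁ x + A₁₂ x * U x)ᴴ) + (ε : ℂ) • ((U x * A₁₂ x)ᴴ * z) - (A₁₂ x)ᴴ

variable {ε a₁₁ a₁₂ a₂₁ R : ℝ}
  {A₁₁ : ℝ → Matrix (Fin n₁) (Fin n₁) ℂ} {A₁₂ : ℝ → Matrix (Fin n₁) (Fin n₂) ℂ}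
  {A₂₁ : ℝ → Matrix (Fin n₂) (Fin n₁) ℂ} {U : ℝ → Matrix (Fin n₂) (Fin n₁) ℂ}

theorem continuous_riccatiForcing (h₁₁ : Continuous A₁₁) (h₁₂ : Continuous A₁₂)
    (h₂₁ : Continuous A₂₁) : Continuous fun z : ℝ × Matrix (Fin n₂) (Fin n₁) ℂ =>
      riccatiForcing ε A₁₁ A₁₂ A₂₁ z.1 z.2 := by
  have c₁₁ : Continuous fun z : ℝ × Matrix (Fin n₂) (Fin n₁) ℂ => A₁₁ z.1 :=
    h₁₁.comp continuous_fst
  have c₁₂ : Continuous fun z : ℝ × Matrix (Fin n₂) (Fin n₁) ℂ => A₁₂ z.1 :=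
    h₁₂.comp continuous_fst
  have c₂₁ : Continuous fun z : ℝ × Matrix (Fin n₂) (Fin n₁) ℂ => A₂₁ z.1 :=
    h₂₁.comp continuous_fst
  exact (c₂₁.sub ((continuous_snd.matrix_mul c₁₁).const_smul (ε : ℂ))).sub
    (((continuous_snd.matrix_mul c₁₂).matrix_mul continuous_snd).const_smul (ε : ℂ))

theorem continuous_adjointForcing (h₁₁ : Continuous A₁₁) (h₁₂ : Continuous A₁₂)
    (hU : Continuous U) : Continuous fun z : ℝ × Matrix (Fin n₂) (Fin n₁) ℂ =>
      adjointForcing ε A₁₁ A₁₂ U z.1 z.2 := by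
  have c₁₁ : Continuous fun z : ℝ × Matrix (Fin n₂) (Fin n₁) ℂ => A₁₁ z.1 :=
    h₁₁.comp continuous_fst
  have c₁₂ : Continuous fun z : ℝ × Matrix (Fin n₂) (Fin n₁) ℂ => A₁₂ z.1 :=
    h₁₂.comp continuous_fst
  have cU : Continuous fun z : ℝ × Matrix (Fin n₂) (Fin n₁) ℂ => U z.1 :=
    hU.comp continuous_fst
  exact (((continuous_snd.matrix_mul
    (c₁₁.add (c₁₂.matrix_mul cU)).matrix_conjTranspose).const_smul (ε : ℂ)).add
    (((cU.matrix_mul c₁₂).matrix_conjTranspose.matrix_mul continuous_snd).const_smul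
      (ε : ℂ))).sub c₁₂.matrix_conjTranspose

theorem norm_riccatiForcing_sub_le (hε : 0 ≤ ε) (h₁₁ : ∀ x, ‖A₁₁ x‖ ≤ a₁₁)
    (h₁₂ : ∀ x, ‖A₁₂ x‖ ≤ a₁₂) (x : ℝ) (v w : Matrix (Fin n₂) (Fin n₁) ℂ) (hv : ‖v‖ ≤ R)
    (hw : ‖w‖ ≤ R) :
    ‖riccatiForcing ε A₁₁ A₁₂ A₂₁ x v - riccatiForcing ε A₁₁ A₁₂ A₂₁ x w‖ ≤
      ε * (a₁₁ + 2 * R * a₁₂) * ‖v - w‖ := by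
  have e : riccatiForcing ε A₁₁ A₁₂ A₂₁ x v - riccatiForcing ε A₁₁ A₁₂ A₂₁ x w =
      (ε : ℂ) • ((w - v) * A₁₁ x + (w - v) * A₁₂ x * v + w * A₁₂ x * (w - v)) := by
    simp only [riccatiForcing, Matrix.sub_mul, Matrix.mul_sub]
    module
  rw [e]
  have hd : ‖w - v‖ ≤ ‖v - w‖ := (norm_sub_rev w v).le
  refine (norm_ofReal_smul_le hε (norm_add₃_le.trans (add_le_add_three
    (norm_mul_le_of_le hd (h₁₁ x)) (norm_mul_le_of_le (norm_mul_le_of_le hd (h₁₂ x)) hv)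
    (norm_mul_le_of_le (norm_mul_le_of_le hw (h₁₂ x)) hd)))).trans (le_of_eq ?_)
  ring

theorem norm_adjointForcing_sub_le (hε : 0 ≤ ε) (h₁₁ : ∀ x, ‖A₁₁ x‖ ≤ a₁₁)
    (h₁₂ : ∀ x, ‖A₁₂ x‖ ≤ a₁₂) (hU : ∀ x, ‖U x‖ ≤ R) (x : ℝ)
    (v w : Matrix (Fin n₂) (Fin n₁) ℂ) :
    ‖adjointForcing ε A₁₁ A₁₂ U x v - adjointForcing ε A₁₁ A₁₂ U x w‖ ≤
      ε * (a₁₁ + 2 * R * a₁₂) * ‖v - w‖ := by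
  have e : adjointForcing ε A₁₁ A₁₂ U x v - adjointForcing ε A₁₁ A₁₂ U x w =
      (ε : ℂ) • ((v - w) * (A₁₁ x + A₁₂ x * U x)ᴴ + (U x * A₁₂ x)ᴴ * (v - w)) := by
    simp only [adjointForcing, Matrix.sub_mul, Matrix.mul_sub]
    module
  rw [e]
  have b₁ : ‖(A₁₁ x + A₁₂ x * U x)ᴴ‖ ≤ a₁₁ + a₁₂ * R := by
    rw [Matrix.l2_opNorm_conjTranspose]
    exact (norm_add_le _ _).trans (add_le_add (h₁₁ x) (norm_mul_le_of_le (h₁₂ x) (hU x)))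
  have b₂ : ‖(U x * A₁₂ x)ᴴ‖ ≤ R * a₁₂ := by
    rw [Matrix.l2_opNorm_conjTranspose]
    exact norm_mul_le_of_le (hU x) (h₁₂ x)
  refine (norm_ofReal_smul_le hε ((norm_add_le _ _).trans (add_le_add
    (norm_mul_le_of_le le_rfl b₁) (norm_mul_le_of_le b₂ le_rfl)))).trans (le_of_eq ?_)
  ring

/-- The term linear in `v` stands apart because the local estimate absorbs it, while the bracket
becomes the local forcing `g`. -/
theorem norm_riccatiForcing_le (hε : 0 ≤ ε) (h₁₁ : ∀ x, ‖A₁₁ x‖ ≤ a₁₁)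
    (h₁₂ : ∀ x, ‖A₁₂ x‖ ≤ a₁₂) (x : ℝ) (v : Matrix (Fin n₂) (Fin n₁) ℂ) :
    ‖riccatiForcing ε A₁₁ A₁₂ A₂₁ x v‖ ≤
      ε * a₁₁ * ‖v‖ + (ε * a₁₂ * ‖v‖ ^ 2 + ‖A₂₁ x‖) := by
  have b₁ := norm_ofReal_smul_le hε (norm_mul_le_of_le (le_refl ‖v‖) (h₁₁ x))
  have b₂ := norm_ofReal_smul_le hε
    (norm_mul_le_of_le (norm_mul_le_of_le (le_refl ‖v‖) (h₁₂ x)) (le_refl ‖v‖))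
  have b₃ := norm_sub_le (A₂₁ x - (ε : ℂ) • (v * A₁₁ x)) ((ε : ℂ) • (v * A₁₂ x * v))
  have b₄ := norm_sub_le (A₂₁ x) ((ε : ℂ) • (v * A₁₁ x))
  rw [riccatiForcing]
  linarith

theorem norm_adjointForcing_le (hε : 0 ≤ ε) (h₁₁ : ∀ x, ‖A₁₁ x‖ ≤ a₁₁)
    (h₁₂ : ∀ x, ‖A₁₂ x‖ ≤ a₁₂) (hU : ∀ x, ‖U x‖ ≤ R) (x : ℝ)
    (v : Matrix (Fin n₂) (Fin n₁) ℂ) :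
    ‖adjointForcing ε A₁₁ A₁₂ U x v‖ ≤ ε * (a₁₁ + 2 * R * a₁₂) * ‖v‖ + a₁₂ := by
  have b := norm_adjointForcing_sub_le hε h₁₁ h₁₂ hU x v 0
  have e : adjointForcing ε A₁₁ A₁₂ U x 0 = -(A₁₂ x)ᴴ := by simp [adjointForcing]
  rw [e, sub_zero, sub_neg_eq_add] at b
  have b' : ‖(A₁₂ x)ᴴ‖ ≤ a₁₂ := by rw [Matrix.l2_opNorm_conjTranspose]; exact h₁₂ x
  have := norm_sub_le (adjointForcing ε A₁₁ A₁₂ U x v + (A₁₂ x)ᴴ) (A₁₂ x)ᴴ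
  rw [add_sub_cancel_right] at this
  linarith

variable {A₂₂ : ℝ → Matrix (Fin n₂) (Fin n₂) ℂ} {B K μ : ℝ}

/-- The bounded solutions of the Riccati equations, for small `ε`. -/
theorem HasExpDichotomy.exists_isRiccatiPair (h : HasExpDichotomy A₂₂ K μ)
    (hK : 0 < K) (hμ : 0 < μ) (hε : 0 ≤ ε)
    (hB : ∀ x, ‖A₂₂ x‖ ≤ B) (h₁₁ : ∀ x, ‖A₁₁ x‖ ≤ a₁₁) (h₁₂ : ∀ x, ‖A₁₂ x‖ ≤ a₁₂)
    (h₂₁ : ∀ x, ‖A₂₁ x‖ ≤ a₂₁)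
    (c₁₁ : Continuous A₁₁) (c₁₂ : Continuous A₁₂) (c₂₁ : Continuous A₂₁) (c₂₂ : Continuous A₂₂)
    (hR : R = 8 * K * μ⁻¹ * a₂₁) (hsmall : 8 * K / μ * (ε * (a₁₁ + 2 * R * a₁₂)) ≤ 1) :
    ∃ (U : ℝ → Matrix (Fin n₂) (Fin n₁) ℂ) (S : ℝ → Matrix (Fin n₁) (Fin n₂) ℂ),
      IsRiccatiPair ε A₁₁ A₁₂ A₂₁ A₂₂ U S ∧ (∀ x, ‖U x‖ ≤ R) ∧
      (∀ x, ‖S x‖ ≤ 8 * K * μ⁻¹ * a₁₂) ∧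
      (∀ x, HasDerivAt U (A₂₂ x * U x + riccatiForcing ε A₁₁ A₁₂ A₂₁ x (U x)) x) ∧
      ∀ L : ℝ, Function.Periodic A₁₁ L → Function.Periodic A₁₂ L → Function.Periodic A₂₁ L →
        Function.Periodic A₂₂ L → Function.Periodic U L ∧ Function.Periodic S L := by
  have ha₁₁ : 0 ≤ a₁₁ := (norm_nonneg _).trans (h₁₁ 0)
  have ha₁₂ : 0 ≤ a₁₂ := (norm_nonneg _).trans (h₁₂ 0)
  have ha₂₁ : 0 ≤ a₂₁ := (norm_nonneg _).trans (h₂₁ 0)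
  have hR0 : 0 ≤ R := by rw [hR]; positivity
  set q := ε * (a₁₁ + 2 * R * a₁₂) with hq
  have hq0 : 0 ≤ q := by positivity
  -- The margin `1/4` serves twice: as contraction constant, and for invariance of the ball, since
  -- `2K/μ * (q R + a₂₁) ≤ R/4 + R/4`. The same count applies to `S` with radius `r`.
  have hq4 : 2 * K / μ * q ≤ 1 / 4 := by
    have e : 8 * K / μ * q = 4 * (2 * K / μ * q) := by ring
    linarith
  have hq1 : 2 * K / μ * q < 1 := by linarith
  have hKμ : 0 < 2 * K / μ := by positivity
  have cN := continuous_riccatiForcing (ε := ε) c₁₁ c₁₂ c₂₁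
  have lipN := fun x v w => norm_riccatiForcing_sub_le (A₂₁ := A₂₁) (R := R) hε h₁₁ h₁₂ x v w
  obtain ⟨U, hUR, hU⟩ := h.exists_semilinear hB hK hμ hR0 cN hq0 hq1 lipN (fun x v hv => by
    have b := norm_riccatiForcing_le (A₂₁ := A₂₁) hε h₁₁ h₁₂ x v
    have b' : ‖riccatiForcing ε A₁₁ A₁₂ A₂₁ x v‖ ≤ q * R + a₂₁ := by
      have i₁ : ε * a₁₁ * ‖v‖ ≤ ε * a₁₁ * R := by gcongr
      have i₂ : ε * a₁₂ * ‖v‖ ^ 2 ≤ ε * a₁₂ * R ^ 2 := by gcongr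
      have i₃ : 0 ≤ ε * a₁₂ * R ^ 2 := by positivity
      have := h₂₁ x
      rw [hq]; nlinarith
    have i := mul_le_mul_of_nonneg_left b' hKμ.le
    have j := mul_le_mul_of_nonneg_right hq4 hR0
    have e : 2 * K / μ * a₂₁ = R / 4 := by rw [hR]; ring
    linarith)
  have cU : Continuous U := continuous_iff_continuousAt.2 fun x => (hU x).continuousAt
  have h' := h.adjoint hB
  have hB' : ∀ x, ‖-(A₂₂ x)ᴴ‖ ≤ B := fun x => by
    rw [norm_neg, Matrix.l2_opNorm_conjTranspose]; exact hB x
  set r := 8 * K * μ⁻¹ * a₁₂ with hr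
  have hr0 : 0 ≤ r := by positivity
  have cN' := continuous_adjointForcing (ε := ε) c₁₁ c₁₂ cU
  have lipN' := norm_adjointForcing_sub_le hε h₁₁ h₁₂ hUR
  obtain ⟨Z, hZr, hZ⟩ := h'.exists_semilinear hB' hK hμ hr0 cN' hq0 hq1
    (fun x v w _ _ => lipN' x v w) (fun x v hv => by
      have b := norm_adjointForcing_le hε h₁₁ h₁₂ hUR x v
      have i₁ : q * ‖v‖ ≤ q * r := by gcongr
      have i := mul_le_mul_of_nonneg_left (b.trans (add_le_add_left i₁ a₁₂)) hKμ.le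
      have j := mul_le_mul_of_nonneg_right hq4 hr0
      have e : 2 * K / μ * a₁₂ = r / 4 := by rw [hr]; ring
      linarith)
  have hU' : ∀ x, HasDerivAt U (A₂₂ x * U x - (ε : ℂ) • (U x * A₁₁ x) -
      (ε : ℂ) • (U x * A₁₂ x * U x) + A₂₁ x) x := fun x => by
    have e : A₂₂ x * U x - (ε : ℂ) • (U x * A₁₁ x) - (ε : ℂ) • (U x * A₁₂ x * U x) + A₂₁ x =
        A₂₂ x * U x + riccatiForcing ε A₁₁ A₁₂ A₂₁ x (U x) := by
      rw [riccatiForcing]; abel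
    rw [e]; exact hU x
  have hS' : ∀ x, HasDerivAt (fun x => (Z x)ᴴ)
      ((ε : ℂ) • ((A₁₁ x + A₁₂ x * U x) * (Z x)ᴴ) -
        (Z x)ᴴ * (A₂₂ x - (ε : ℂ) • (U x * A₁₂ x)) - A₁₂ x) x := fun x => by
    have e : (ε : ℂ) • ((A₁₁ x + A₁₂ x * U x) * (Z x)ᴴ) -
        (Z x)ᴴ * (A₂₂ x - (ε : ℂ) • (U x * A₁₂ x)) - A₁₂ x =
        (-(A₂₂ x)ᴴ * Z x + adjointForcing ε A₁₁ A₁₂ U x (Z x))ᴴ := by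
      simp only [adjointForcing, Matrix.conjTranspose_add, Matrix.conjTranspose_sub,
        Matrix.conjTranspose_mul, Matrix.conjTranspose_smul, Matrix.conjTranspose_neg,
        Matrix.conjTranspose_conjTranspose, Matrix.mul_sub, Matrix.mul_neg, Matrix.mul_smul,
        Complex.star_def, Complex.conj_ofReal]
      abel
    rw [e]; exact hasDerivAt_matrix_conjTranspose (hZ x)
  have cS : Continuous fun x => (Z x)ᴴ :=
    continuous_iff_continuousAt.2 fun x => (hS' x).continuousAt
  refine ⟨U, fun x => (Z x)ᴴ, ⟨contDiff_one_of_hasDerivAt hU' ?_,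
    contDiff_one_of_hasDerivAt hS' ?_, hU', hS'⟩, hUR, fun x => ?_, hU, ?_⟩
  · exact (((c₂₂.matrix_mul cU).sub ((cU.matrix_mul c₁₁).const_smul (ε : ℂ))).sub
      (((cU.matrix_mul c₁₂).matrix_mul cU).const_smul (ε : ℂ))).add c₂₁
  · exact ((((c₁₁.add (c₁₂.matrix_mul cU)).matrix_mul cS).const_smul (ε : ℂ)).sub
      (cS.matrix_mul (c₂₂.sub ((cU.matrix_mul c₁₂).const_smul (ε : ℂ))))).sub c₁₂
  · rw [Matrix.l2_opNorm_conjTranspose]; exact hZr x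
  · intro L p₁₁ p₁₂ p₂₁ p₂₂
    -- The translate by `L` solves the same equation in the same ball.
    have pU : (fun x => U (x + L)) = U := by
      refine h.semilinear_unique hB hμ cN hq0 hq1 lipN (fun x => hUR (x + L)) hUR
        (fun x => ?_) hU
      have := (hU (x + L)).comp_add_const x L
      simpa only [riccatiForcing, p₁₁ x, p₁₂ x, p₂₁ x, p₂₂ x] using this
    have pZ : (fun x => Z (x + L)) = Z := by
      refine h'.semilinear_unique hB' hμ cN' hq0 hq1 (fun x v w _ _ => lipN' x v w)
        (fun x => hZr (x + L)) hZr (fun x => ?_) hZ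
      have := (hZ (x + L)).comp_add_const x L
      simpa only [adjointForcing, p₁₁ x, p₁₂ x, p₂₂ x, congrFun pU x] using this
    exact ⟨fun x => congrFun pU x, fun x => congrArg Matrix.conjTranspose (congrFun pZ x)⟩

end Riccati

end SlowFast

/-! ### The main theorem. -/

open SlowFast in
theorem mainTheorem4 :
    -- the constants: `C₁` depends on `K₀`; `C₃` on `K₀, μ₀, ‖A₁₁‖, ‖A₁₂‖, ‖A₂₁‖`;
    -- `C₄` on `K₀, μ₀, ‖A₁₂‖, ‖A₂₁‖`
    ∃ (C₁ : ℝ → ℝ) (C₃ : ℝ → ℝ → ℝ → ℝ → ℝ → ℝ) (C₄ : ℝ → ℝ → ℝ → ℝ → ℝ),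
      (∀ k, 0 < C₁ k) ∧ (∀ k m a b c, 0 < C₃ k m a b c) ∧ (∀ k m b c, 0 < C₄ k m b c) ∧
      ∀ (n₁ n₂ : ℕ), 0 < n₁ → 0 < n₂ →
      ∀ (ε₀ : ℝ), 0 < ε₀ →
      ∀ (A₁₁ : (ℝ × Set.Ioo (0 : ℝ) ε₀) →ᵇ Matrix (Fin n₁) (Fin n₁) ℂ)
        (A₁₂ : (ℝ × Set.Ioo (0 : ℝ) ε₀) →ᵇ Matrix (Fin n₁) (Fin n₂) ℂ)
        (A₂₁ : (ℝ × Set.Ioo (0 : ℝ) ε₀) →ᵇ Matrix (Fin n₂) (Fin n₁) ℂ)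
        (A₂₂ : (ℝ × Set.Ioo (0 : ℝ) ε₀) →ᵇ Matrix (Fin n₂) (Fin n₂) ℂ)
        (K₀ μ₀ : ℝ), 0 < K₀ → 0 < μ₀ →
      (∀ ε : Set.Ioo (0 : ℝ) ε₀, HasExpDichotomy (fun x => A₂₂ (x, ε)) K₀ μ₀) →
      ∃ ε₁ : ℝ, 0 < ε₁ ∧ ∀ ε : Set.Ioo (0 : ℝ) ε₀, (ε : ℝ) < ε₁ →
        ∃ (U : ℝ → Matrix (Fin n₂) (Fin n₁) ℂ) (S : ℝ → Matrix (Fin n₁) (Fin n₂) ℂ),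
          IsRiccatiPair (ε : ℝ) (fun x => A₁₁ (x, ε)) (fun x => A₁₂ (x, ε))
            (fun x => A₂₁ (x, ε)) (fun x => A₂₂ (x, ε)) U S ∧
          -- 1. uniform bounds
          (∀ x, ‖U x‖ ≤ 8 * K₀ * μ₀⁻¹ * ‖A₂₁‖) ∧
          (∀ x, ‖S x‖ ≤ 8 * C₁ K₀ * μ₀⁻¹ * ‖A₁₂‖) ∧
          -- 2. block diagonalization
          Transforms (riccatiTransform (ε : ℝ) U S)
            (coupled (ε : ℝ) (fun x => A₁₁ (x, ε)) (fun x => A₁₂ (x, ε))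
              (fun x => A₂₁ (x, ε)) (fun x => A₂₂ (x, ε)))
            (decoupled (ε : ℝ) (fun x => A₁₁ (x, ε)) (fun x => A₁₂ (x, ε))
              (fun x => A₂₂ (x, ε)) U) ∧
          -- 3. closeness to the unique bounded solution of the inhomogeneous problem
          (∃ Ω : ℝ → Matrix (Fin n₂) (Fin n₁) ℂ,
            IsBoundedInhomSolution (fun x => A₂₁ (x, ε)) (fun x => A₂₂ (x, ε)) Ω ∧
            (∀ Ω' : ℝ → Matrix (Fin n₂) (Fin n₁) ℂ,
              IsBoundedInhomSolution (fun x => A₂₁ (x, ε)) (fun x => A₂₂ (x, ε)) Ω' → Ω' = Ω) ∧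
            ∀ θ : ℝ, 0 < θ → θ < 1 → ∀ x,
              ‖U x - Ω x‖ ≤ C₃ K₀ μ₀ ‖A₁₁‖ ‖A₁₂‖ ‖A₂₁‖ * (ε : ℝ) ^ (1 - θ)) ∧
          -- 4. local estimate
          (∀ a : ℝ, 0 < a → ∀ x,
            ‖U x‖ ≤ 4 * K₀ / μ₀ *
              ((⨆ y : Set.Icc (x - a) (x + a),
                  ((ε : ℝ) * ‖A₁₂‖ * ‖U y‖ ^ 2 + ‖A₂₁ ((y : ℝ), ε)‖)) +
                C₄ K₀ μ₀ ‖A₁₂‖ ‖A₂₁‖ * Real.exp (-a * μ₀ / 2))) ∧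
          -- 5. periodicity
          (∀ L : ℝ,
            Function.Periodic (fun x => A₁₁ (x, ε)) L →
            Function.Periodic (fun x => A₁₂ (x, ε)) L →
            Function.Periodic (fun x => A₂₁ (x, ε)) L →
            Function.Periodic (fun x => A₂₂ (x, ε)) L →
            Function.Periodic (riccatiTransform (ε : ℝ) U S) L) := by
  -- `C₁ = K₀` would do for the bound on `S`; absolute values and `+ 1` make the constants positive
  -- for all arguments. In `C₃` and `C₄`, `8 * k * μ⁻¹ * c` is the radius `R`. The factor `2` in
  -- `C₄` counts the two exponentials of the weight at its centre.
  refine ⟨fun k => |k| + 1,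
    fun k μ a b c => |2 * k / μ * (a * (8 * k * μ⁻¹ * c) + b * (8 * k * μ⁻¹ * c) ^ 2)| + 1,
    fun k μ b c => 2 * (|b * (8 * k * μ⁻¹ * c) ^ 2 + c| + 1),
    fun _ => by positivity, fun _ _ _ _ _ => by positivity, fun _ _ _ _ => by positivity, ?_⟩
  intro n₁ n₂ _ _ ε₀ _ A₁₁ A₁₂ A₂₁ A₂₂ K₀ μ₀ hK hμ hdich
  set R := 8 * K₀ * μ₀⁻¹ * ‖A₂₁‖ with hR
  have hR0 : 0 ≤ R := by positivity
  set Q := 8 * K₀ / μ₀ * (‖A₁₁‖ + 2 * R * ‖A₁₂‖) with hQ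
  have hQ0 : 0 ≤ Q := by positivity
  -- The bound `1 / (Q + 1)` makes `ε * Q ≤ 1`, also when `Q = 0`; the bound `1` gives `ε ≤ ε ^ (1 -
  -- θ)` and removes `ε` from the bound on the quadratic term.
  refine ⟨min 1 (1 / (Q + 1)), by positivity, fun ε hε => ?_⟩
  have hε0 : (0 : ℝ) < ε := ε.2.1
  have hε1 : (ε : ℝ) ≤ 1 := hε.le.trans (min_le_left _ _)
  have hεQ : (ε : ℝ) * (Q + 1) < 1 := by
    rw [← lt_div_iff₀ (by positivity)]; exact hε.trans_le (min_le_right _ _)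
  have hsmall : 8 * K₀ / μ₀ * (ε * (‖A₁₁‖ + 2 * R * ‖A₁₂‖)) ≤ 1 := by
    have e : 8 * K₀ / μ₀ * (ε * (‖A₁₁‖ + 2 * R * ‖A₁₂‖)) = ε * Q := by rw [hQ]; ring
    rw [e]; linarith
  have b₁₁ : ∀ x, ‖A₁₁ (x, ε)‖ ≤ ‖A₁₁‖ := fun x => A₁₁.norm_coe_le_norm _
  have b₁₂ : ∀ x, ‖A₁₂ (x, ε)‖ ≤ ‖A₁₂‖ := fun x => A₁₂.norm_coe_le_norm _
  have b₂₁ : ∀ x, ‖A₂₁ (x, ε)‖ ≤ ‖A₂₁‖ := fun x => A₂₁.norm_coe_le_norm _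
  have b₂₂ : ∀ x, ‖A₂₂ (x, ε)‖ ≤ ‖A₂₂‖ := fun x => A₂₂.norm_coe_le_norm _
  have cp : Continuous fun x : ℝ => (x, ε) := by fun_prop
  have c₁₁ : Continuous fun x => A₁₁ (x, ε) := A₁₁.continuous.comp cp
  have c₁₂ : Continuous fun x => A₁₂ (x, ε) := A₁₂.continuous.comp cp
  have c₂₁ : Continuous fun x => A₂₁ (x, ε) := A₂₁.continuous.comp cp
  have c₂₂ : Continuous fun x => A₂₂ (x, ε) := A₂₂.continuous.comp cp
  obtain ⟨U, S, hpair, hUR, hSr, hU, hper⟩ := (hdich ε).exists_isRiccatiPair hK hμ hε0.le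
    b₂₂ b₁₁ b₁₂ b₂₁ c₁₁ c₁₂ c₂₁ c₂₂ hR hsmall
  have cU : Continuous U := hpair.1.continuous
  have cF : Continuous fun x => riccatiForcing (ε : ℝ) (fun x => A₁₁ (x, ε))
      (fun x => A₁₂ (x, ε)) (fun x => A₂₁ (x, ε)) x (U x) :=
    (continuous_riccatiForcing c₁₁ c₁₂ c₂₁).comp (continuous_id.prodMk cU)
  have bU : ∀ x, (ε : ℝ) * ‖A₁₂‖ * ‖U x‖ ^ 2 + ‖A₂₁ (x, ε)‖ ≤ ‖A₁₂‖ * R ^ 2 + ‖A₂₁‖ := fun x => by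
    refine add_le_add ?_ (b₂₁ x)
    calc (ε : ℝ) * ‖A₁₂‖ * ‖U x‖ ^ 2 ≤ 1 * ‖A₁₂‖ * R ^ 2 := by
          gcongr; exact hUR x
      _ = _ := by ring
  have bF := fun x => norm_riccatiForcing_le (A₂₁ := fun x => A₂₁ (x, ε)) hε0.le b₁₁ b₁₂ x (U x)
  refine ⟨U, S, hpair, hUR, fun x => (hSr x).trans ?_, hpair.transforms, ?_, ?_, ?_⟩
  · gcongr
    linarith [le_abs_self K₀]
  · obtain ⟨Ω, hΩ, hΩb⟩ := (hdich ε).exists_bounded_solution_norm_le b₂₂ hμ c₂₁ b₂₁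
    refine ⟨Ω, ⟨⟨_, hΩb⟩, hΩ⟩, fun Ω' hΩ' => ?_, fun θ hθ _ x => ?_⟩
    · obtain ⟨⟨D, hD⟩, hΩ'⟩ := hΩ'
      exact (hdich ε).bounded_solution_unique b₂₂ hμ hD hΩb hΩ' hΩ
    · have hd := (hdich ε).norm_le b₂₂ hμ (V := fun x => U x - Ω x)
        (C := ε * (‖A₁₁‖ * R + ‖A₁₂‖ * R ^ 2)) (cF.sub c₂₁) (fun y => ?_)
        (fun y => (norm_sub_le _ _).trans (add_le_add (hUR y) (hΩb y))) (fun y => ?_) x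
      · refine hd.trans ?_
        have hpow : (ε : ℝ) ≤ (ε : ℝ) ^ (1 - θ) := by
          simpa using Real.rpow_le_rpow_of_exponent_ge hε0 hε1 (by linarith : 1 - θ ≤ 1)
        calc 2 * K₀ / μ₀ * (ε * (‖A₁₁‖ * R + ‖A₁₂‖ * R ^ 2))
            = 2 * K₀ / μ₀ * (‖A₁₁‖ * R + ‖A₁₂‖ * R ^ 2) * ε := by ring
          _ ≤ (|2 * K₀ / μ₀ * (‖A₁₁‖ * R + ‖A₁₂‖ * R ^ 2)| + 1) * (ε : ℝ) ^ (1 - θ) :=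
            mul_le_mul ((le_abs_self _).trans (by linarith)) hpow hε0.le (by positivity)
      -- Subtracting `A₂₁` leaves the Riccati forcing with `A₂₁ = 0`, in which every term carries a
      -- factor `ε`.
      · have e : riccatiForcing (ε : ℝ) (fun x => A₁₁ (x, ε)) (fun x => A₁₂ (x, ε))
            (fun x => A₂₁ (x, ε)) y (U y) - A₂₁ (y, ε) = riccatiForcing (ε : ℝ)
            (fun x => A₁₁ (x, ε)) (fun x => A₁₂ (x, ε)) 0 y (U y) := by
          simp only [riccatiForcing, Pi.zero_apply]; abel
        rw [Pi.sub_apply, e]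
        refine (norm_riccatiForcing_le hε0.le b₁₁ b₁₂ y (U y)).trans ?_
        have i₁ : ε * ‖A₁₁‖ * ‖U y‖ ≤ ε * ‖A₁₁‖ * R := by gcongr; exact hUR y
        have i₂ : ε * ‖A₁₂‖ * ‖U y‖ ^ 2 ≤ ε * ‖A₁₂‖ * R ^ 2 := by gcongr; exact hUR y
        rw [Pi.zero_apply, norm_zero]
        linarith
      · have e : A₂₂ (y, ε) * (U y - Ω y) + (riccatiForcing (ε : ℝ) (fun x => A₁₁ (x, ε))
            (fun x => A₁₂ (x, ε)) (fun x => A₂₁ (x, ε)) y (U y) - A₂₁ (y, ε)) =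
            (A₂₂ (y, ε) * U y + riccatiForcing (ε : ℝ) (fun x => A₁₁ (x, ε))
            (fun x => A₁₂ (x, ε)) (fun x => A₂₁ (x, ε)) y (U y)) -
            (A₂₂ (y, ε) * Ω y + A₂₁ (y, ε)) := by
          rw [Matrix.mul_sub]; abel
        rw [Pi.sub_apply, e]
        exact (hU y).sub (hΩ y)
  · intro a ha x
    have hbdd : BddAbove (Set.range fun y : Set.Icc (x - a) (x + a) =>
        (ε : ℝ) * ‖A₁₂‖ * ‖U y‖ ^ 2 + ‖A₂₁ ((y : ℝ), ε)‖) :=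
      ⟨_, by rintro _ ⟨y, rfl⟩; exact bU y⟩
    -- Only the linear coefficient `ε * ‖A₁₁‖` plays the role of `q`; the quadratic term stays in
    -- `g`, as the claimed bound requires.
    refine (hdich ε).local_norm_le b₂₂ hK hμ (D := R) (q := ε * ‖A₁₁‖)
      (C := ε * ‖A₁₁‖ * R + (‖A₁₂‖ * R ^ 2 + ‖A₂₁‖)) cF (fun y => ?_) hUR hU (by positivity) ?_
      bF (Real.iSup_nonneg fun y => by positivity) (by positivity)
      (fun y hy => le_ciSup hbdd ⟨y, hy⟩) (fun y => ?_)
    · refine (bF y).trans (add_le_add ?_ (bU y))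
      gcongr; exact hUR y
    · refine le_trans ?_ hsmall
      gcongr
      linarith [mul_nonneg (mul_nonneg zero_le_two hR0) (norm_nonneg A₁₂)]
    · exact (bU y).trans ((le_abs_self _).trans (by linarith))
  · intro L p₁₁ p₁₂ p₂₁ p₂₂ x
    obtain ⟨pU, pS⟩ := hper L p₁₁ p₁₂ p₂₁ p₂₂
    simp only [riccatiTransform, pU x, pS x]
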